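/- **Setting.** There are $n\ge 1$ workers. Worker $i$ needs $h_i>0$ seconds to compute one stochastic gradient. The workers are the nodes of a connected graph $\bar G$; each edge $\{i,j\}$ has a bandwidth $b_{ij}=b_{ji}>0$ and can carry, in each of its two directions, $b_{ij}$ coordinates per second. Let $T=(V,F,w)$ be a Gomory–Hu tree of $\bar G$, and let $\bar w_1=\min_{\{i,j\}\in F}w_{ij}$ be its smallest weight ($\bar w_1=\infty$ and $d/\bar w_1=0$ if $n=1$). The objective is $f=\frac1n\sum_{i=1}^n f_i$ on $\mathbb R^d$. Worker $i$ can only compute stochastic gradients $\nabla f_i(x;\xi)$ with $\mathbb E_\xi[\nabla f_i(x;\xi)]=\nabla f_i(x)$ and $\mathbb E_\xi\|\nabla f_i(x;\xi)-\nabla f_i(x)\|^2\le\sigma^2$ for all $x$, where the samples $\xi$ are independent and identically distributed. **Algorithms.** Each worker $i$ has a set $I_i$ of vectors, initially empty, and runs two loops in parallel; local operations other than gradient computations take no time. 1. Computation: the worker repeatedly selects, from its local information, a point $x$ with $\mathrm{supp}(x)\subseteq\bigcup_{y\in I_i}\mathrm{supp}(y)$, computes $\nabla f_i(x;\xi)$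 with a fresh sample $\xi$ during $h_i$ seconds, and adds the result to $I_i$. It may wait before the next computation, and this decision may depend on its local information. 2. Communication: for $k=0,1,\dots$ the worker selects, from its local information, a vector $s$ with $\mathrm{supp}(s)\subseteq\bigcup_{y\in I_i}\mathrm{supp}(y)$ and sends to another worker $j$ finitely many (at least one) pairs $(\nu,c\,s_\nu)$ with indices $\nu\in\{1,\dots,d\}$ and coefficients $c\in\mathbb R$. Each pair counts as one coordinate. It does not wait for the delivery. The pairs travel through $\bar G$ by any routing that respects the bandwidths, and when all of them have arrived, $\sum c\,s_\nu e_\nu$ is added to $I_j$. The worker may wait before the next sending. The algorithm may be randomized. The indices $\nu$, the coefficients $c$, the destinations, the sending times and the routes may be random (functions of a random seed that is independent of the samples $\xi$), but they do not depend on the local information, the functions $f_i$ or the oracles. Everything else may depend on the seed. **Theorem.** There are universal constants $\bar c_1,\bar c_2,\bar c_3>0$ such that the following holds for every such environment and all $L,\Delta,\varepsilon,\sigma^2>0$ and $d\in\mathbb N$ with $\frac{L\Delta}{\varepsilon}\ge\bar c_1$ and $d\ge\bar c_3\frac{L\Delta}{\varepsilon}$. For every such algorithm there are differentiable functions $f_1,\dots,f_n:\mathbb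 R^d\to\mathbb R$, with $f=\frac1n\sum_i f_i$ satisfying $\|\nabla f(x)-\nabla f(y)\|\le L\|x-y\|$ for all $x,y$ and $f(0)-\inf f\le\Delta$, and stochastic gradient oracles as above, such that $$\mathbb E\Big[\inf_{y\in G_t}\|\nabla f(y)\|^2\Big]>\varepsilon$$ for all $$0\le t\le\bar c_2\,\max\Big\{\frac{d}{\bar w_1},\ \max_{i}h_i,\ \frac{\sigma^2}{n\varepsilon}\Big(\frac1n\sum_{i=1}^n h_i\Big)\Big\}\,\frac{L\Delta}{\varepsilon},$$ where $G_t$ is the set of all points $y$ with $\mathrm{supp}(y)\subseteq\bigcup_{v\in I_i}\mathrm{supp}(v)$ for some worker $i$, with $I_i$ taken at time $t$. -/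

import Mathlib

open MeasureTheory
open scoped NNReal ENNReal

noncomputable section

namespace Decentralized

/-! ### Vectors and supports -/

/-- The space `ℝ^d` with the Euclidean norm. -/
abbrev Vec (d : ℕ) : Type := EuclideanSpace ℝ (Fin d)

/-- The support of a vector. -/
def supp {d : ℕ} (x : Vec d) : Set (Fin d) := {j | x j ≠ 0}

/-! ### The environment: computation times and bandwidths -/

/-- `n` workers; worker `i` needs `h i` seconds for one stochastic gradient, and the
communication network is a connected graph in which every edge `{i, j}` can carry
`b i j = b j i > 0` coordinates per second in each of its two directions
(`b i j = 0` when there is no edge). -/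
structure Environment (n : ℕ) where
  h : Fin n → ℝ≥0
  h_pos : ∀ i, 0 < h i
  graph : SimpleGraph (Fin n)
  connected : graph.Connected
  b : Fin n → Fin n → ℝ≥0
  b_pos_iff : ∀ i j, 0 < b i j ↔ graph.Adj i j
  b_symm : ∀ i j, b i j = b j i

open Classical in
/-- The value of the cut `(U, V \ U)` in the undirected weighted graph. -/
def Environment.cutValue {n : ℕ} (env : Environment n) (U : Set (Fin n)) : ℝ≥0 :=
  ∑ u, ∑ v, if u ∈ U ∧ v ∉ U then env.b u v else 0

/-- `U` is a minimum `i`-`j` cut. -/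
def Environment.IsMinCut {n : ℕ} (env : Environment n) (i j : Fin n) (U : Set (Fin n)) : Prop :=
  i ∈ U ∧ j ∉ U ∧ ∀ U' : Set (Fin n), i ∈ U' → j ∉ U' → env.cutValue U ≤ env.cutValue U'

/-- The component of `i` after the edge `{i, j}` has been removed from `T`. -/
def sideOf {n : ℕ} (T : SimpleGraph (Fin n)) (i j : Fin n) : Set (Fin n) :=
  {v | (T.deleteEdges {s(i, j)}).Reachable i v}

/-- `(T, w)` is a Gomory--Hu tree: for each tree edge `{i, j}`, the two components of
`T - {i, j}` form a minimum `i`-`j` cut, and `w i j` is the value of this cut. -/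
structure Environment.IsGomoryHuTree {n : ℕ} (env : Environment n)
    (T : SimpleGraph (Fin n)) (w : Fin n → Fin n → ℝ≥0) : Prop where
  isTree : T.IsTree
  isMinCut : ∀ i j, T.Adj i j → env.IsMinCut i j (sideOf T i j)
  weight_eq : ∀ i j, T.Adj i j → w i j = env.cutValue (sideOf T i j)

/-- The smallest edge weight of a weighted tree (`∞` when there is no edge). -/
def minWeight {n : ℕ} (T : SimpleGraph (Fin n)) (w : Fin n → Fin n → ℝ≥0) : ℝ≥0∞ :=
  ⨅ (i : Fin n) (j : Fin n) (_ : T.Adj i j), (w i j : ℝ≥0∞)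

/-! ### Transmissions -/

/-- One realization of everything that concerns the transmissions, except for the vectors
that are sparsified. The `k`-th message of worker `i` is issued at time `sendTime i k`
(`∞`: never) to worker `dest i k`; it consists of the `size i k` pairs
`(ν, c * s_ν)`, with `ν = idx i k j` and `c = coef i k j` for `j < size i k`, where `s` is the
vector that worker `i` sparsifies.

Routing: `flow i k j u v t` is the amount of data of the `j`-th coordinate of that message that
has been transmitted from `u` to `v` up to time `t`; a coordinate is one unit of data. -/
structure Schedule {n : ℕ} (env : Environment n) (d : ℕ) where
  sendTime : Fin n → ℕ → ℝ≥0∞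
  sendTime_mono : ∀ i, Monotone (sendTime i)
  dest : Fin n → ℕ → Fin n
  dest_ne : ∀ i k, sendTime i k ≠ ∞ → dest i k ≠ i
  size : Fin n → ℕ → ℕ
  size_pos : ∀ i k, 1 ≤ size i k
  idx : Fin n → ℕ → ℕ → Fin d
  coef : Fin n → ℕ → ℕ → ℝ
  flow : Fin n → ℕ → ℕ → Fin n → Fin n → ℝ≥0 → ℝ≥0
  flow_mono : ∀ i k j u v, Monotone (flow i k j u v)
  /-- No data of a message moves before the message is issued. -/
  flow_start : ∀ i k j u v (t : ℝ≥0), (t : ℝ≥0∞) ≤ sendTime i k → flow i k j u v t = 0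
  /-- A worker other than the sender forwards no more than it has received. -/
  flow_conserve : ∀ i k j v t, v ≠ i → ∑ u, flow i k j v u t ≤ ∑ u, flow i k j u v t
  /-- The destination keeps the data. -/
  flow_dest : ∀ i k j u t, flow i k j (dest i k) u t = 0
  /-- The bandwidths are respected: during any time interval `[t, t + r]`, all messages together
  move at most `b u v * r` coordinates from `u` to `v`. -/
  capacity : ∀ (u v : Fin n) (t r : ℝ≥0) (Q : Finset (Fin n × ℕ × ℕ)),
    ∑ q ∈ Q, flow q.1 q.2.1 q.2.2 u v (t + r) ≤ ∑ q ∈ Q, flow q.1 q.2.1 q.2.2 u v t + env.b u v * r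

/-- The `k`-th message of worker `i` has completely arrived at its destination by time `t`. -/
def Schedule.Arrived {n d : ℕ} {env : Environment n} (S : Schedule env d)
    (i : Fin n) (k : ℕ) (t : ℝ≥0) : Prop :=
  ∀ j < S.size i k, 1 ≤ ∑ u, S.flow i k j u (S.dest i k) t

/-- What the receiver of the `k`-th message of worker `i` obtains when `s` is the vector that
worker `i` sparsifies: `∑ c * s_ν * e_ν`. -/
def Schedule.decode {n d : ℕ} {env : Environment n} (S : Schedule env d)
    (i : Fin n) (k : ℕ) (s : Vec d) : Vec d :=
  ∑ j ∈ Finset.range (S.size i k),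
    EuclideanSpace.single (S.idx i k j) (S.coef i k j * s (S.idx i k j))

/-! ### Local information and algorithms -/

/-- The local information of a worker: its `m`-th stochastic gradient together with the time of
its completion (`none` as long as it is not complete), and the vector obtained from the `k`-th
message of each worker (`none` if that message has not arrived here). -/
structure LocalInfo (n d : ℕ) where
  grads : ℕ → Option (ℝ≥0∞ × Vec d)
  msgs : Fin n → ℕ → Option (Vec d)

/-- The set of all vectors that are available to the worker. -/
def LocalInfo.vectors {n d : ℕ} (I : LocalInfo n d) : Set (Vec d) :=
  {y | (∃ m c, I.grads m = some (c, y)) ∨ ∃ i k, I.msgs i k = some y}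

/-- The union of the supports of all vectors that are available to the worker. -/
def LocalInfo.support {n d : ℕ} (I : LocalInfo n d) : Set (Fin d) :=
  ⋃ y ∈ I.vectors, supp y

/-- A (randomized, asynchronous) zero-respecting algorithm for `n` workers in dimension `d`.
`Z` is the space of its random seed, which is available to all workers.

The schedule of the transmissions (sparsifiers, destinations, sending times, routes) is random,
but it does not take the local information into account. Everything else is adaptive:
* an idle worker `i` starts its `m`-th gradient computation as soon as the time is at least
  `plan ζ i m I`, where `I` is its current information (`∞`: wait for new information);
* `point ζ i m I` is the point at which the `m`-th stochastic gradient of worker `i` is computed,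
  where `I` is the information of worker `i` when it starts this computation;
* `vec ζ i k I` is the vector that is sparsified to give the `k`-th message of worker `i`, where
  `I` is the information of worker `i` when it issues this message.

No measurability of the adaptive rules is needed: expectations below are lower integrals. -/
structure Algorithm {n : ℕ} (env : Environment n) (d : ℕ) (Z : Type*) [MeasurableSpace Z] where
  seedLaw : Measure Z
  isProbabilityMeasure : IsProbabilityMeasure seedLaw
  schedule : Z → Schedule env d
  measurable_sendTime : ∀ i k, Measurable fun ζ => (schedule ζ).sendTime i k
  measurable_dest : ∀ i k, Measurable fun ζ => (schedule ζ).dest i k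
  measurable_size : ∀ i k, Measurable fun ζ => (schedule ζ).size i k
  measurable_idx : ∀ i k j, Measurable fun ζ => (schedule ζ).idx i k j
  measurable_coef : ∀ i k j, Measurable fun ζ => (schedule ζ).coef i k j
  measurable_flow : ∀ i k j u v t, Measurable fun ζ => (schedule ζ).flow i k j u v t
  plan : Z → Fin n → ℕ → LocalInfo n d → ℝ≥0∞
  point : Z → Fin n → ℕ → LocalInfo n d → Vec d
  supp_point : ∀ ζ i m I, supp (point ζ i m I) ⊆ I.support
  vec : Z → Fin n → ℕ → LocalInfo n d → Vec d
  supp_vec : ∀ ζ i k I, supp (vec ζ i k I) ⊆ I.support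

/-! ### Problems and oracles -/

/-- A heterogeneous problem: differentiable functions `f 0, …, f (n-1)` on `ℝ^d` and, for each
worker `i`, a stochastic gradient `grad i x ξ`, `ξ ∼ D`, of `f i` that is unbiased and has variance
at most `σ2`. -/
structure HeterogeneousProblem (n d : ℕ) (σ2 : ℝ) where
  f : Fin n → Vec d → ℝ
  differentiable : ∀ i, Differentiable ℝ (f i)
  Ξ : Type
  measurableSpace : MeasurableSpace Ξ
  D : Measure Ξ
  isProbabilityMeasure : IsProbabilityMeasure D
  grad : Fin n → Vec d → Ξ → Vec d
  measurable_grad : ∀ i, Measurable (Function.uncurry (grad i))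
  integrable_grad : ∀ i x, Integrable (grad i x) D
  unbiased : ∀ i x, ∫ ξ, grad i x ξ ∂D = gradient (f i) x
  variance_le : ∀ i x,
    ∫⁻ ξ, ENNReal.ofReal (‖grad i x ξ - gradient (f i) x‖ ^ 2) ∂D ≤ ENNReal.ofReal σ2

attribute [instance] HeterogeneousProblem.measurableSpace
attribute [instance] HeterogeneousProblem.isProbabilityMeasure
attribute [instance] Algorithm.isProbabilityMeasure

/-- The objective `f = (1/n) ∑ f i`. -/
def HeterogeneousProblem.objective {n d : ℕ} {σ2 : ℝ} (P : HeterogeneousProblem n d σ2)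
    (x : Vec d) : ℝ :=
  (1 / (n : ℝ)) * ∑ i, P.f i x

/-- `f` is differentiable, its gradient is `L`-Lipschitz, and `f 0 - inf f ≤ Δ`. -/
structure InClass {d : ℕ} (Δ L : ℝ) (f : Vec d → ℝ) : Prop where
  differentiable : Differentiable ℝ f
  smooth : ∀ x y, ‖gradient f x - gradient f y‖ ≤ L * ‖x - y‖
  bddBelow : BddBelow (Set.range f)
  gap : f 0 - ⨅ x, f x ≤ Δ

/-! ### Execution of an algorithm -/

/-- What happens in an execution: `start i m` is the time at which worker `i` starts its `m`-th
gradient computation (`∞`: never), `point i m` the point at which the gradient is computed,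
and `vec i k` the vector that is sparsified to give the `k`-th message of worker `i`. -/
structure Trace (n d : ℕ) where
  start : Fin n → ℕ → ℝ≥0∞
  point : Fin n → ℕ → Vec d
  vec : Fin n → ℕ → Vec d

section Execution

variable {n d : ℕ} {env : Environment n} {Ξ : Type}

open Classical in
/-- The local information of worker `i` at time `t`: the gradients completed and the messages that
have arrived up to (and including) time `t`. Here `g` is the stochastic gradient oracle, and
`ξ (i, m)` is the noise in the `m`-th stochastic gradient of worker `i`. -/
def Trace.info (r : Trace n d) (S : Schedule env d) (g : Fin n → Vec d → Ξ → Vec d)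
    (ξ : Fin n × ℕ → Ξ) (i : Fin n) (t : ℝ≥0) : LocalInfo n d where
  grads m :=
    if r.start i m + env.h i ≤ t then
      some (r.start i m + env.h i, g i (r.point i m) (ξ (i, m)))
    else none
  msgs i' k :=
    if S.dest i' k = i ∧ S.Arrived i' k t then some (S.decode i' k (r.vec i' k)) else none

/-- The time from which on worker `i` is idle before its `m`-th gradient computation. -/
def Trace.idleFrom (r : Trace n d) (env : Environment n) (i : Fin n) : ℕ → ℝ≥0∞
  | 0 => 0
  | m + 1 => r.start i m + env.h i

/-- `r` is the execution of the algorithm `A` with the seed `ζ`, the stochastic gradients `g`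
and the noise `ξ`. -/
structure Algorithm.IsExecution {Z : Type*} [MeasurableSpace Z] (A : Algorithm env d Z) (ζ : Z)
    (g : Fin n → Vec d → Ξ → Vec d) (ξ : Fin n × ℕ → Ξ) (r : Trace n d) : Prop where
  start_eq : ∀ i m, r.start i m = sInf {t : ℝ≥0∞ | ∃ s : ℝ≥0, t = s ∧
    r.idleFrom env i m ≤ s ∧ A.plan ζ i m (r.info (A.schedule ζ) g ξ i s) ≤ s}
  point_eq : ∀ i m (s : ℝ≥0), r.start i m = s →
    r.point i m = A.point ζ i m (r.info (A.schedule ζ) g ξ i s)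
  vec_eq : ∀ i k (s : ℝ≥0), (A.schedule ζ).sendTime i k = s →
    r.vec i k = A.vec ζ i k (r.info (A.schedule ζ) g ξ i s)

/-! The execution exists, and it is unique as far as the local information is concerned: every
piece of new information is delayed by a positive time. -/

theorem Environment.exists_delay (env : Environment n) : ∃ δ : ℝ≥0, 0 < δ ∧ (∀ i, δ ≤ env.h i) ∧
    ∀ {d : ℕ} (S : Schedule env d) (i : Fin n) (k : ℕ) (t : ℝ≥0), S.Arrived i k t →
      S.sendTime i k + δ ≤ t := by
  set B : ℝ≥0 := 1 + ∑ v, ∑ u, env.b u v + ∑ i, (env.h i)⁻¹ with hB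
  have hB0 : 0 < B := by positivity
  refine ⟨B⁻¹, inv_pos.2 hB0, fun i => ?_, fun {d} S i k t hA => ?_⟩
  · have h1 : (env.h i)⁻¹ ≤ B :=
      (Finset.single_le_sum (f := fun i => (env.h i)⁻¹) (fun _ _ => zero_le) (Finset.mem_univ i)).trans
        le_add_self
    exact inv_le_of_inv_le₀ (env.h_pos i) h1
  · have h1 := hA 0 (S.size_pos i k)
    have hlt : S.sendTime i k < t := by
      by_contra hcon
      have h2 : ∀ u, S.flow i k 0 u (S.dest i k) t = 0 := fun u =>
        S.flow_start i k 0 u _ t (not_lt.1 hcon)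
      simp [h2] at h1
    have hne : S.sendTime i k ≠ ∞ := hlt.ne_top
    lift S.sendTime i k to ℝ≥0 using hne with a ha
    have hlt' : a ≤ t := by exact_mod_cast hlt.le
    obtain ⟨r, rfl⟩ := exists_add_of_le hlt'
    have h3 : ∀ u, S.flow i k 0 u (S.dest i k) (a + r) ≤ env.b u (S.dest i k) * r := fun u => by
      have h4 := S.capacity u (S.dest i k) a r {(i, k, 0)}
      simpa [S.flow_start i k 0 u (S.dest i k) a ha.le] using h4
    have h5 : 1 ≤ B * r := by
      calc 1 ≤ ∑ u, S.flow i k 0 u (S.dest i k) (a + r) := h1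
        _ ≤ ∑ u, env.b u (S.dest i k) * r := Finset.sum_le_sum fun u _ => h3 u
        _ = (∑ u, env.b u (S.dest i k)) * r := by rw [Finset.sum_mul]
        _ ≤ B * r := by
          gcongr
          have h6 : ∑ u, env.b u (S.dest i k) ≤ ∑ v, ∑ u, env.b u v :=
            Finset.single_le_sum (f := fun v => ∑ u, env.b u v) (fun _ _ => zero_le)
              (Finset.mem_univ _)
          exact h6.trans (le_add_self.trans le_self_add)
    have h7 : B⁻¹ ≤ r := by
      rw [inv_le_iff_one_le_mul₀ hB0, mul_comm]; exact h5
    exact_mod_cast add_le_add_right h7 a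

/-- The traces `p` and `q` coincide before time `T`. -/
def Trace.Agree (S : Schedule env d) (T : ℝ≥0∞) (p q : Trace n d) : Prop :=
  (∀ i m, (p.start i m < T ∨ q.start i m < T) →
    p.start i m = q.start i m ∧ p.point i m = q.point i m) ∧
  ∀ i k, S.sendTime i k < T → p.vec i k = q.vec i k

theorem Trace.Agree.symm {S : Schedule env d} {T : ℝ≥0∞} {p q : Trace n d}
    (h : Trace.Agree S T p q) : Trace.Agree S T q p :=
  ⟨fun i m hh => ⟨(h.1 i m hh.symm).1.symm, (h.1 i m hh.symm).2.symm⟩,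
    fun i k hh => (h.2 i k hh).symm⟩

theorem Trace.Agree.trans {S : Schedule env d} {T : ℝ≥0∞} {p q r : Trace n d}
    (h : Trace.Agree S T p q) (h' : Trace.Agree S T q r) : Trace.Agree S T p r := by
  refine ⟨fun i m hh => ?_, fun i k hh => (h.2 i k hh).trans (h'.2 i k hh)⟩
  rcases hh with hh | hh
  · have h1 := h.1 i m (Or.inl hh)
    have h2 := h'.1 i m (Or.inl (h1.1 ▸ hh))
    exact ⟨h1.1.trans h2.1, h1.2.trans h2.2⟩
  · have h2 := h'.1 i m (Or.inr hh)
    have h1 := h.1 i m (Or.inr (h2.1.symm ▸ hh))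
    exact ⟨h1.1.trans h2.1, h1.2.trans h2.2⟩

theorem Trace.Agree.mono {S : Schedule env d} {T T' : ℝ≥0∞} {p q : Trace n d}
    (h : Trace.Agree S T p q) (hT : T' ≤ T) : Trace.Agree S T' p q :=
  ⟨fun i m hh => h.1 i m (hh.imp (fun x => x.trans_le hT) fun x => x.trans_le hT),
    fun i k hh => h.2 i k (hh.trans_le hT)⟩

theorem Trace.Agree.start_iff {S : Schedule env d} {T : ℝ≥0∞} {p q : Trace n d} {δ : ℝ≥0}
    (hh : ∀ i, δ ≤ env.h i) (h : Trace.Agree S T p q) {t : ℝ≥0∞} (ht : t < T + δ)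
    {i : Fin n} {m : ℕ} (hp : p.start i m + env.h i ≤ t) :
    p.start i m = q.start i m ∧ p.point i m = q.point i m := by
  refine h.1 i m (Or.inl ?_)
  have h1 : p.start i m + δ < T + δ :=
    lt_of_le_of_lt ((add_le_add_right (by exact_mod_cast hh i) _).trans hp) ht
  exact lt_of_add_lt_add_right h1

theorem Trace.Agree.info_eq {S : Schedule env d} {T : ℝ≥0∞} {p q : Trace n d} {δ : ℝ≥0}
    (hh : ∀ i, δ ≤ env.h i)
    (hS : ∀ (i : Fin n) (k : ℕ) (t : ℝ≥0), S.Arrived i k t → S.sendTime i k + δ ≤ t)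
    (h : Trace.Agree S T p q) (g : Fin n → Vec d → Ξ → Vec d) (ξ : Fin n × ℕ → Ξ)
    (i : Fin n) (t : ℝ≥0) (ht : (t : ℝ≥0∞) < T + δ) :
    p.info S g ξ i t = q.info S g ξ i t := by
  unfold Trace.info
  congr 1
  · funext m
    by_cases hp : p.start i m + env.h i ≤ t
    · have h1 := h.start_iff hh ht hp
      have hq := hp
      rw [h1.1] at hq
      rw [if_pos hp, if_pos hq, h1.1, h1.2]
    · by_cases hq : q.start i m + env.h i ≤ t
      · exact absurd ((h.symm.start_iff hh ht hq).1 ▸ hq) hp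
      · rw [if_neg hp, if_neg hq]
  · funext i' k
    by_cases hA : S.dest i' k = i ∧ S.Arrived i' k t
    · have h1 : S.sendTime i' k + δ < T + δ := (hS i' k t hA.2).trans_lt ht
      rw [if_pos hA, if_pos hA, h.2 i' k (lt_of_add_lt_add_right h1)]
    · rw [if_neg hA, if_neg hA]

/-- The right-hand sides of the equations that characterize an execution. -/
def Algorithm.step {Z : Type*} [MeasurableSpace Z] (A : Algorithm env d Z) (ζ : Z)
    (g : Fin n → Vec d → Ξ → Vec d) (ξ : Fin n × ℕ → Ξ) (r : Trace n d) : Trace n d :=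
  let start := fun i m => sInf {t : ℝ≥0∞ | ∃ s : ℝ≥0, t = s ∧
    r.idleFrom env i m ≤ s ∧ A.plan ζ i m (r.info (A.schedule ζ) g ξ i s) ≤ s}
  { start := start
    point := fun i m => A.point ζ i m (r.info (A.schedule ζ) g ξ i (start i m).toNNReal)
    vec := fun i k =>
      A.vec ζ i k (r.info (A.schedule ζ) g ξ i ((A.schedule ζ).sendTime i k).toNNReal) }

theorem sInf_le_of_agree {U V : Set ℝ≥0∞} {c : ℝ≥0∞} (h : ∀ t < c, t ∈ U → t ∈ V)
    (hc : sInf U < c) : sInf V ≤ sInf U := by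
  obtain ⟨a, haU, hac⟩ := sInf_lt_iff.1 hc
  refine le_sInf fun x hx => ?_
  by_cases hxc : x < c
  · exact sInf_le (h x hxc hx)
  · exact (sInf_le (h a hac haU)).trans (hac.le.trans (not_lt.1 hxc))

theorem sInf_eq_of_agree {U V : Set ℝ≥0∞} {c : ℝ≥0∞} (h : ∀ t < c, t ∈ U ↔ t ∈ V)
    (hc : sInf U < c ∨ sInf V < c) : sInf U = sInf V := by
  rcases hc with hc | hc
  · have h1 := sInf_le_of_agree (fun t ht => (h t ht).1) hc
    exact le_antisymm (sInf_le_of_agree (fun t ht => (h t ht).2) (h1.trans_lt hc)) h1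
  · have h1 := sInf_le_of_agree (fun t ht => (h t ht).2) hc
    exact le_antisymm h1 (sInf_le_of_agree (fun t ht => (h t ht).1) (h1.trans_lt hc))

section Existence

variable {Z : Type*} [MeasurableSpace Z] {A : Algorithm env d Z} {ζ : Z}
  {g : Fin n → Vec d → Ξ → Vec d} {ξ : Fin n × ℕ → Ξ}

theorem Trace.Agree.step {T : ℝ≥0∞} {p q : Trace n d} {δ : ℝ≥0}
    (hh : ∀ i, δ ≤ env.h i)
    (hS : ∀ (i : Fin n) (k : ℕ) (t : ℝ≥0), (A.schedule ζ).Arrived i k t →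
      (A.schedule ζ).sendTime i k + δ ≤ t)
    (h : Trace.Agree (A.schedule ζ) T p q) :
    Trace.Agree (A.schedule ζ) (T + δ) (A.step ζ g ξ p) (A.step ζ g ξ q) := by
  have hidle : ∀ {p q : Trace n d}, Trace.Agree (A.schedule ζ) T p q → ∀ i m (s : ℝ≥0),
      (s : ℝ≥0∞) < T + δ → p.idleFrom env i m ≤ s → q.idleFrom env i m ≤ s := by
    intro p q h i m s hs hp
    cases m with
    | zero => exact hp
    | succ m =>
      have h1 := (h.start_iff hh hs hp).1
      simpa only [Trace.idleFrom, h1] using hp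
  have hstart : ∀ i m, ((A.step ζ g ξ p).start i m < T + δ ∨ (A.step ζ g ξ q).start i m < T + δ) →
      (A.step ζ g ξ p).start i m = (A.step ζ g ξ q).start i m := by
    intro i m hlt
    refine sInf_eq_of_agree (c := T + δ) (fun t ht => ?_) hlt
    constructor
    · rintro ⟨s, rfl, h1, h2⟩
      exact ⟨s, rfl, hidle h i m s ht h1, h.info_eq hh hS g ξ i s ht ▸ h2⟩
    · rintro ⟨s, rfl, h1, h2⟩
      exact ⟨s, rfl, hidle h.symm i m s ht h1, (h.info_eq hh hS g ξ i s ht).symm ▸ h2⟩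
  refine ⟨fun i m hlt => ?_, fun i k hlt => ?_⟩
  · have h1 := hstart i m hlt
    refine ⟨h1, ?_⟩
    have h2 : (A.step ζ g ξ p).start i m < T + δ := hlt.elim id fun x => h1 ▸ x
    have h3 : (((A.step ζ g ξ p).start i m).toNNReal : ℝ≥0∞) < T + δ := by
      rwa [ENNReal.coe_toNNReal h2.ne_top]
    change A.point ζ i m (p.info (A.schedule ζ) g ξ i ((A.step ζ g ξ p).start i m).toNNReal) =
      A.point ζ i m (q.info (A.schedule ζ) g ξ i ((A.step ζ g ξ q).start i m).toNNReal)
    rw [← h1, h.info_eq hh hS g ξ i _ h3]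
  · have h3 : (((A.schedule ζ).sendTime i k).toNNReal : ℝ≥0∞) < T + δ := by
      rwa [ENNReal.coe_toNNReal hlt.ne_top]
    change A.vec ζ i k (p.info (A.schedule ζ) g ξ i _) = A.vec ζ i k (q.info (A.schedule ζ) g ξ i _)
    rw [h.info_eq hh hS g ξ i _ h3]

theorem Algorithm.isExecution_of_agree {r : Trace n d}
    (h : ∀ T : ℝ≥0, Trace.Agree (A.schedule ζ) T r (A.step ζ g ξ r)) :
    A.IsExecution ζ g ξ r := by
  have hs : ∀ i m, r.start i m = (A.step ζ g ξ r).start i m := by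
    intro i m
    by_cases h1 : r.start i m = ∞ ∧ (A.step ζ g ξ r).start i m = ∞
    · rw [h1.1, h1.2]
    · have h2 : ∃ T : ℝ≥0, r.start i m < T ∨ (A.step ζ g ξ r).start i m < T := by
        rw [not_and_or] at h1
        rcases h1 with h1 | h1
        · obtain ⟨T, hT⟩ := ENNReal.lt_iff_exists_nnreal_btwn.1 (lt_top_iff_ne_top.2 h1)
          exact ⟨T, Or.inl hT.1⟩
        · obtain ⟨T, hT⟩ := ENNReal.lt_iff_exists_nnreal_btwn.1 (lt_top_iff_ne_top.2 h1)
          exact ⟨T, Or.inr hT.1⟩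
      obtain ⟨T, hT⟩ := h2
      exact ((h T).1 i m hT).1
  refine ⟨hs, fun i m s hsm => ?_, fun i k s hsm => ?_⟩
  · have h1 : r.start i m < (s + 1 : ℝ≥0) := by
      rw [hsm]; exact_mod_cast lt_add_one s
    have h2 := ((h (s + 1)).1 i m (Or.inl h1)).2
    rw [h2]
    change A.point ζ i m (r.info (A.schedule ζ) g ξ i ((A.step ζ g ξ r).start i m).toNNReal) = _
    rw [← hs, hsm, ENNReal.toNNReal_coe]
  · have h1 : (A.schedule ζ).sendTime i k < (s + 1 : ℝ≥0) := by
      rw [hsm]; exact_mod_cast lt_add_one s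
    rw [(h (s + 1)).2 i k h1]
    change A.vec ζ i k (r.info (A.schedule ζ) g ξ i ((A.schedule ζ).sendTime i k).toNNReal) = _
    rw [hsm, ENNReal.toNNReal_coe]

theorem Algorithm.IsExecution.agree {r : Trace n d} (h : A.IsExecution ζ g ξ r) (T : ℝ≥0) :
    Trace.Agree (A.schedule ζ) T r (A.step ζ g ξ r) := by
  have hs : ∀ i m, r.start i m = (A.step ζ g ξ r).start i m := h.start_eq
  refine ⟨fun i m hlt => ⟨hs i m, ?_⟩, fun i k hlt => ?_⟩
  · have h1 : r.start i m < T := hlt.elim id fun x => (hs i m).symm ▸ x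
    change _ = A.point ζ i m (r.info (A.schedule ζ) g ξ i ((A.step ζ g ξ r).start i m).toNNReal)
    rw [← hs]
    exact h.point_eq i m _ (ENNReal.coe_toNNReal h1.ne_top).symm
  · exact h.vec_eq i k _ (ENNReal.coe_toNNReal hlt.ne_top).symm

open Classical in
theorem Algorithm.exists_isExecution (A : Algorithm env d Z) (ζ : Z)
    (g : Fin n → Vec d → Ξ → Vec d) (ξ : Fin n × ℕ → Ξ) : ∃ r, A.IsExecution ζ g ξ r := by
  obtain ⟨δ, hδ, hh, hS⟩ := env.exists_delay
  have hS' := fun i k t => hS (A.schedule ζ) i k t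
  let p : ℕ → Trace n d := fun N => (A.step ζ g ξ)^[N] ⟨fun _ _ => ∞, fun _ _ => 0, fun _ _ => 0⟩
  have hp : ∀ N, p (N + 1) = A.step ζ g ξ (p N) := fun N => Function.iterate_succ_apply' _ _ _
  let τ : ℕ → ℝ≥0∞ := fun N => ((N * δ : ℝ≥0) : ℝ≥0∞)
  have hτ : ∀ N, τ (N + 1) = τ N + δ := fun N => by simp [τ, add_mul]
  have hτm : Monotone τ := fun a b hab => by
    have : (a : ℝ≥0) ≤ b := by exact_mod_cast hab
    simp only [τ, ENNReal.coe_le_coe]; gcongr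
  have hτlt : ∀ T : ℝ≥0, ∃ N, (T : ℝ≥0∞) ≤ τ N := fun T => by
    obtain ⟨N, hN⟩ := exists_nat_ge (T / δ)
    refine ⟨N, ?_⟩
    simp only [τ, ENNReal.coe_le_coe]
    rwa [div_le_iff₀ hδ] at hN
  have hagree1 : ∀ N, Trace.Agree (A.schedule ζ) (τ N) (p N) (p (N + 1)) := by
    intro N
    induction N with
    | zero => simp [Trace.Agree, τ]
    | succ N ih =>
      rw [hτ, hp (N + 1)]
      nth_rewrite 1 [hp N]
      exact ih.step hh hS'
  have hagree : ∀ N M, N ≤ M → Trace.Agree (A.schedule ζ) (τ N) (p N) (p M) := by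
    intro N M hNM
    induction M, hNM using Nat.le_induction with
    | base => exact ⟨fun _ _ _ => ⟨rfl, rfl⟩, fun _ _ _ => rfl⟩
    | succ M hM ih => exact ih.trans ((hagree1 M).mono (hτm hM))
  let r : Trace n d :=
    { start := fun i m => if H : ∃ N, (p N).start i m < τ N then (p H.choose).start i m else ∞
      point := fun i m => if H : ∃ N, (p N).start i m < τ N then (p H.choose).point i m else 0
      vec := fun i k => if H : ∃ N, (A.schedule ζ).sendTime i k < τ N then (p H.choose).vec i k
        else 0 }
  have hr : ∀ N, Trace.Agree (A.schedule ζ) (τ N) r (p N) := by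
    intro N
    have key : ∀ i m M, (p M).start i m < τ M →
        ((p M).start i m < τ N ∨ (p N).start i m < τ N) →
        (p M).start i m = (p N).start i m ∧ (p M).point i m = (p N).point i m := by
      intro i m M hM hN
      rcases le_total N M with h | h
      · have h1 := (hagree N M h).1 i m hN.symm
        exact ⟨h1.1.symm, h1.2.symm⟩
      · exact (hagree M N h).1 i m (Or.inl hM)
    refine ⟨fun i m hlt => ?_, fun i k hlt => ?_⟩
    · by_cases H : ∃ N, (p N).start i m < τ N
      · have h1 : r.start i m = (p H.choose).start i m := dif_pos H
        have h2 : r.point i m = (p H.choose).point i m := dif_pos H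
        rw [h1] at hlt ⊢
        rw [h2]
        exact key i m _ H.choose_spec hlt
      · have h1 : r.start i m = ∞ := dif_neg H
        rcases hlt with hlt | hlt
        · rw [h1] at hlt; exact absurd hlt not_top_lt
        · exact absurd ⟨N, hlt⟩ H
    · have H : ∃ N, (A.schedule ζ).sendTime i k < τ N := ⟨N, hlt⟩
      have h1 : r.vec i k = (p H.choose).vec i k := dif_pos H
      rw [h1]
      rcases le_total N H.choose with h | h
      · exact ((hagree N _ h).2 i k hlt).symm
      · exact (hagree _ N h).2 i k H.choose_spec
  refine ⟨r, Algorithm.isExecution_of_agree fun T => ?_⟩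
  obtain ⟨N, hN⟩ := hτlt T
  have h1 : Trace.Agree (A.schedule ζ) (τ (N + 1)) (A.step ζ g ξ r) (p (N + 1)) := by
    rw [hτ, hp]; exact (hr N).step hh hS'
  exact ((hr (N + 1)).trans h1.symm).mono (hN.trans (hτm (Nat.le_succ N)))

theorem Algorithm.IsExecution.info_unique {r r' : Trace n d} (h : A.IsExecution ζ g ξ r)
    (h' : A.IsExecution ζ g ξ r') (i : Fin n) (t : ℝ≥0) :
    r.info (A.schedule ζ) g ξ i t = r'.info (A.schedule ζ) g ξ i t := by
  obtain ⟨δ, hδ, hh, hS⟩ := env.exists_delay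
  have hS' := fun i k t => hS (A.schedule ζ) i k t
  have key : ∀ N : ℕ, Trace.Agree (A.schedule ζ) ((N * δ : ℝ≥0) : ℝ≥0∞) r r' := by
    intro N
    induction N with
    | zero => simp [Trace.Agree]
    | succ N ih =>
      have h1 := ih.step (g := g) (ξ := ξ) hh hS'
      have h2 : (((N + 1 : ℕ) * δ : ℝ≥0) : ℝ≥0∞) = ((N * δ : ℝ≥0) : ℝ≥0∞) + δ := by
        simp [add_mul]
      rw [← h2] at h1
      exact ((h.agree _).trans h1).trans (h'.agree _).symm
  obtain ⟨N, hN⟩ := exists_nat_ge (t / δ)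
  rw [div_le_iff₀ hδ] at hN
  refine (key N).info_eq hh hS' g ξ i t ?_
  have : t < N * δ + δ := lt_of_le_of_lt hN (lt_add_of_pos_right _ hδ)
  exact_mod_cast this

end Existence

/-- The execution of the algorithm `A` with the seed `ζ`, the stochastic gradients `g` and the
noise `ξ`. -/
def Algorithm.run {Z : Type*} [MeasurableSpace Z] (A : Algorithm env d Z) (ζ : Z)
    (g : Fin n → Vec d → Ξ → Vec d) (ξ : Fin n × ℕ → Ξ) : Trace n d :=
  (A.exists_isExecution ζ g ξ).choose

theorem Algorithm.isExecution_run {Z : Type*} [MeasurableSpace Z] (A : Algorithm env d Z) (ζ : Z)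
    (g : Fin n → Vec d → Ξ → Vec d) (ξ : Fin n × ℕ → Ξ) :
    A.IsExecution ζ g ξ (A.run ζ g ξ) :=
  (A.exists_isExecution ζ g ξ).choose_spec

/-- The set of all points that some worker can construct from its local information at time `t`
(the local information only grows with time). -/
def Algorithm.reachable {Z : Type*} [MeasurableSpace Z] (A : Algorithm env d Z) (ζ : Z)
    (g : Fin n → Vec d → Ξ → Vec d) (ξ : Fin n × ℕ → Ξ) (t : ℝ≥0) : Set (Vec d) :=
  {y | ∃ i, supp y ⊆ ((A.run ζ g ξ).info (A.schedule ζ) g ξ i t).support}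

/-- `E[inf ‖∇f(y)‖²]`, the infimum over all points `y` that can be constructed up to time `t`; the
expectation is over the seed of the algorithm and over the independent noises in all stochastic
gradients. -/
def Algorithm.expectedInf {Z : Type*} [MeasurableSpace Z] {σ2 : ℝ} (A : Algorithm env d Z)
    (P : HeterogeneousProblem n d σ2) (t : ℝ≥0) : ℝ≥0∞ :=
  ∫⁻ ω, ⨅ y ∈ A.reachable ω.1 P.grad ω.2 t, ENNReal.ofReal (‖gradient P.objective y‖ ^ 2)
    ∂(A.seedLaw.prod (Measure.infinitePi fun _ : Fin n × ℕ => P.D))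

end Execution

end Decentralized

end

open Decentralized
open scoped NNReal ENNReal

/-! The hard objective is a chain of `T`, of order `L * Δ / ε`, coordinates `e 0, …, e (T - 1)`. It
is a rescaling `a * F (c • x)` of the sum `F` of the links `penalty x_{m+1} - link x_m * gate
x_{m+1}`, where `x_0 = 1` is a constant and `x_{m+1}` is the coordinate `e m`. Every link lowers the
value by at most 4, `F` is smooth with a universal constant (`norm_chainGrad_sub_le`), and its
gradient is large as long as the last coordinate is zero (`quarter_le_norm_chainGrad`). Since
`link`, `linkDeriv` and `penaltyDeriv` vanish at 0, a gradient reveals at most the next coordinate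
of the chain, and only to a worker that holds the corresponding link with nonzero weight
(`chainGrad_apply_ne_zero`). The average objective is the same for all weights that sum to `n` on
each link, so the links can be distributed over the workers at will. It then suffices that, with
probability at least 1/2, no worker knows the last coordinate (`Algorithm.lt_expectedInf`). Three
distributions give the three terms of the maximum.

Computation: if one worker holds everything, each new coordinate costs it one gradient.

Variance: worker `i` has weight proportional to `h i`, and its oracle shows the newly discovered
coordinate only with a small probability `p i`, suitably amplified; this uses up the allowed
variance. Progress is at most the number of successful samples (`lt_card_successes`). The number of
samples is limited by the computation times, so Markov's inequality bounds the progress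
(`lt_expectedInf_of_sampling`).

Communication: the links alternate between two workers on the two sides of the cut of a lightest
tree edge. A coordinate revealed on one side must cross the cut before the next one can be revealed,
so `e 0, …, e (M - 1)` have to cross in this order (`crossed_of_mem_support`). The schedule is
independent of the functions, hence the chain can be a uniformly random injective sequence of
indices. In a fixed schedule `N` crossings serve at most `N.choose M * d` of these sequences
(`card_embeddings_le`), which is at most half of them unless `N` is of order `d * M`. Averaging over
the sequences gives one that is bad for the given algorithm (`exists_chain_crossed_le_half`). -/

namespace Decentralized

/-! ### Scalar building blocks of the hard function -/

/-- The square of the positive part. -/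
noncomputable def rampSq (x : ℝ) : ℝ := max x 0 ^ 2

theorem hasDerivAt_rampSq (x : ℝ) : HasDerivAt rampSq (2 * max x 0) x := by
  rcases lt_trichotomy x 0 with hx | rfl | hx
  · rw [max_eq_right hx.le]
    refine (hasDerivAt_const x (0 : ℝ)).congr_of_eventuallyEq ?_ |>.congr_deriv (by simp)
    filter_upwards [gt_mem_nhds hx] with y hy
    simp [rampSq, max_eq_right hy.le]
  · rw [max_self, mul_zero, hasDerivAt_iff_isLittleO]
    have h1 : (fun y : ℝ => rampSq y - rampSq 0 - (y - 0) • (0 : ℝ)) =O[nhds 0]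
        fun y : ℝ => y ^ 2 := by
      refine Asymptotics.IsBigO.of_bound 1 (Filter.Eventually.of_forall fun y => ?_)
      simp only [rampSq, max_self, Real.norm_eq_abs]
      rcases le_total y 0 with h | h
      · simp [max_eq_right h, sq_nonneg]
      · simp [max_eq_left h]
    refine h1.trans_isLittleO ?_
    simpa using Asymptotics.isLittleO_pow_id (𝕜 := ℝ) one_lt_two
  · rw [max_eq_left hx.le]
    refine (hasDerivAt_pow 2 x).congr_of_eventuallyEq ?_ |>.congr_deriv (by simp)
    filter_upwards [lt_mem_nhds hx] with y hy
    simp [rampSq, max_eq_left hy.le]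

theorem abs_max_zero_sub_le (x y : ℝ) : |max x 0 - max y 0| ≤ |x - y| :=
  abs_max_sub_max_le_abs x y 0

/-- A bounded function that vanishes on the negative half-line. -/
noncomputable def link (x : ℝ) : ℝ := rampSq x / (1 + rampSq x)

/-- The derivative of `link`. -/
noncomputable def linkDeriv (x : ℝ) : ℝ := 2 * max x 0 / (1 + max x 0 ^ 2) ^ 2

/-- A bounded increasing function. -/
noncomputable def gate (x : ℝ) : ℝ := Real.pi / 2 + Real.arctan x

/-- The derivative of `gate`. -/
noncomputable def gateDeriv (x : ℝ) : ℝ := 1 / (1 + x ^ 2)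

/-- A penalty on negative values. -/
noncomputable def penalty (x : ℝ) : ℝ := rampSq (-x) / 2

/-- The derivative of `penalty`. -/
noncomputable def penaltyDeriv (x : ℝ) : ℝ := -max (-x) 0

theorem hasDerivAt_link (x : ℝ) : HasDerivAt link (linkDeriv x) x := by
  have h := hasDerivAt_rampSq x
  have h0 : 1 + rampSq x ≠ 0 := by unfold rampSq; positivity
  refine (h.div (h.const_add 1) h0).congr_deriv ?_
  unfold linkDeriv
  rw [show max x 0 ^ 2 = rampSq x from rfl]
  congr 1; ring

theorem hasDerivAt_gate (x : ℝ) : HasDerivAt gate (gateDeriv x) x :=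
  (Real.hasDerivAt_arctan x).const_add _

theorem hasDerivAt_penalty (x : ℝ) : HasDerivAt penalty (penaltyDeriv x) x := by
  have h := ((hasDerivAt_rampSq (-x)).comp x (hasDerivAt_neg x)).div_const 2
  refine h.congr_deriv ?_
  unfold penaltyDeriv; ring

theorem link_nonneg (x : ℝ) : 0 ≤ link x := by unfold link rampSq; positivity

theorem link_le_one (x : ℝ) : link x ≤ 1 := by
  unfold link
  have : 0 ≤ rampSq x := sq_nonneg _
  rw [div_le_one (by positivity)]; linarith

theorem link_of_nonpos {x : ℝ} (hx : x ≤ 0) : link x = 0 := by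
  simp [link, rampSq, max_eq_right hx]

theorem half_le_link {x : ℝ} (hx : 1 ≤ x) : 1 / 2 ≤ link x := by
  unfold link rampSq
  rw [max_eq_left (by linarith), div_le_div_iff₀ (by norm_num) (by positivity)]
  nlinarith

theorem linkDeriv_nonneg (x : ℝ) : 0 ≤ linkDeriv x := by
  have : 0 ≤ max x 0 := le_max_right _ _
  unfold linkDeriv; positivity

theorem linkDeriv_zero : linkDeriv 0 = 0 := by simp [linkDeriv]

/-! ### Bounds and Lipschitz constants of the scalar building blocks. -/

theorem abs_div_one_add_sq_le (p : ℝ) : |p / (1 + p ^ 2)| ≤ 1 := by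
  rw [abs_div, abs_of_pos (show 0 < 1 + p ^ 2 by positivity), div_le_one (by positivity)]
  rcases abs_cases p with ⟨h, _⟩ | ⟨h, _⟩ <;> rw [h] <;> nlinarith [sq_nonneg (p - 1), sq_nonneg (p + 1)]

theorem abs_inv_one_add_sq_sub_le (p q : ℝ) :
    |1 / (1 + p ^ 2) - 1 / (1 + q ^ 2)| ≤ |p - q| := by
  have hp : 0 < 1 + p ^ 2 := by positivity
  have hq : 0 < 1 + q ^ 2 := by positivity
  have h1 : 1 / (1 + p ^ 2) - 1 / (1 + q ^ 2) =
      (p - q) * (-(p + q) / ((1 + p ^ 2) * (1 + q ^ 2))) := by field_simp; ring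
  rw [h1, abs_mul]
  refine mul_le_of_le_one_right (abs_nonneg _) ?_
  rw [abs_div, abs_of_pos (mul_pos hp hq), div_le_one (mul_pos hp hq), abs_le]
  constructor <;>
    nlinarith [sq_nonneg (p - 1), sq_nonneg (p + 1), sq_nonneg (q - 1), sq_nonneg (q + 1),
      sq_nonneg (p * q)]

theorem abs_div_one_add_sq_sub_le (p q : ℝ) :
    |p / (1 + p ^ 2) - q / (1 + q ^ 2)| ≤ |p - q| := by
  have hp : 0 < 1 + p ^ 2 := by positivity
  have hq : 0 < 1 + q ^ 2 := by positivity
  have h1 : p / (1 + p ^ 2) - q / (1 + q ^ 2) =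
      (p - q) * ((1 - p * q) / ((1 + p ^ 2) * (1 + q ^ 2))) := by field_simp; ring
  rw [h1, abs_mul]
  refine mul_le_of_le_one_right (abs_nonneg _) ?_
  rw [abs_div, abs_of_pos (mul_pos hp hq), div_le_one (mul_pos hp hq), abs_le]
  constructor <;> nlinarith [sq_nonneg (p - q), sq_nonneg (p + q), sq_nonneg (p * q)]

theorem abs_mul_sub_mul_le {a b a' b' A B δ η : ℝ} (ha : |a| ≤ A) (hb : |b'| ≤ B)
    (h1 : |a - a'| ≤ δ) (h2 : |b - b'| ≤ η) : |a * b - a' * b'| ≤ A * η + B * δ := by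
  have h : a * b - a' * b' = a * (b - b') + b' * (a - a') := by ring
  rw [h]
  refine (abs_add_le _ _).trans (add_le_add ?_ ?_) <;> rw [abs_mul]
  · exact mul_le_mul ha h2 (abs_nonneg _) ((abs_nonneg _).trans ha)
  · exact mul_le_mul hb h1 (abs_nonneg _) ((abs_nonneg _).trans hb)

/-- Factoring the derivative into two functions of `max x 0` that are bounded by 1 and 1-Lipschitz
lets `abs_mul_sub_mul_le` give its Lipschitz constant. -/
theorem linkDeriv_eq (x : ℝ) :
    linkDeriv x = 2 * (max x 0 / (1 + max x 0 ^ 2) * (1 / (1 + max x 0 ^ 2))) := by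
  unfold linkDeriv
  have : 0 < 1 + max x 0 ^ 2 := by positivity
  field_simp

theorem abs_inv_one_add_sq_le (p : ℝ) : |1 / (1 + p ^ 2)| ≤ 1 := by
  rw [abs_of_pos (by positivity), div_le_one (by positivity)]
  nlinarith [sq_nonneg p]

theorem linkDeriv_le (x : ℝ) : |linkDeriv x| ≤ 2 := by
  rw [linkDeriv_eq, abs_mul, abs_mul, abs_two]
  have h1 := abs_div_one_add_sq_le (max x 0)
  have h2 := abs_inv_one_add_sq_le (max x 0)
  nlinarith [mul_le_mul h1 h2 (abs_nonneg _) zero_le_one]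

theorem abs_linkDeriv_sub_le (x y : ℝ) : |linkDeriv x - linkDeriv y| ≤ 4 * |x - y| := by
  have h0 := abs_max_zero_sub_le x y
  have h := abs_mul_sub_mul_le (abs_div_one_add_sq_le (max x 0))
    (abs_inv_one_add_sq_le (max y 0))
    (abs_div_one_add_sq_sub_le (max x 0) (max y 0)) (abs_inv_one_add_sq_sub_le (max x 0) (max y 0))
  rw [linkDeriv_eq, linkDeriv_eq, ← mul_sub, abs_mul, abs_two]
  linarith

theorem abs_link_sub_le (x y : ℝ) : |link x - link y| ≤ 2 * |x - y| := by
  have h1 : ∀ z, link z = 1 - 1 / (1 + max z 0 ^ 2) := fun z => by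
    have : 0 < 1 + max z 0 ^ 2 := by positivity
    unfold link rampSq; field_simp; ring
  rw [h1, h1, sub_sub_sub_cancel_left, abs_sub_comm]
  have := abs_inv_one_add_sq_sub_le (max x 0) (max y 0)
  have h0 := abs_max_zero_sub_le x y
  linarith [abs_nonneg (x - y)]

theorem gate_pos (x : ℝ) : 0 < gate x := by
  unfold gate; linarith [Real.neg_pi_div_two_lt_arctan x]

theorem gate_le_four (x : ℝ) : gate x ≤ 4 := by
  unfold gate; linarith [Real.arctan_lt_pi_div_two x, Real.pi_le_four]

theorem abs_gate_le (x : ℝ) : |gate x| ≤ 4 := by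
  rw [abs_of_pos (gate_pos x)]; exact gate_le_four x

theorem gateDeriv_pos (x : ℝ) : 0 < gateDeriv x := by unfold gateDeriv; positivity

theorem gateDeriv_zero : gateDeriv 0 = 1 := by simp [gateDeriv]

theorem abs_gateDeriv_le (x : ℝ) : |gateDeriv x| ≤ 1 := abs_inv_one_add_sq_le x

theorem abs_gateDeriv_sub_le (x y : ℝ) : |gateDeriv x - gateDeriv y| ≤ |x - y| :=
  abs_inv_one_add_sq_sub_le x y

theorem abs_gate_sub_le (x y : ℝ) : |gate x - gate y| ≤ |x - y| := by
  have h := Convex.norm_image_sub_le_of_norm_hasDerivWithin_le (f := gate) (f' := gateDeriv)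
    (s := Set.univ) (x := y) (y := x) (C := 1) (fun z _ => (hasDerivAt_gate z).hasDerivWithinAt)
    (fun z _ => by simpa using abs_gateDeriv_le z) convex_univ trivial trivial
  simpa using h

theorem penalty_nonneg (x : ℝ) : 0 ≤ penalty x := by unfold penalty rampSq; positivity

theorem penalty_zero : penalty 0 = 0 := by simp [penalty, rampSq]

theorem penaltyDeriv_nonpos (x : ℝ) : penaltyDeriv x ≤ 0 := by
  simp [penaltyDeriv]

theorem penaltyDeriv_zero : penaltyDeriv 0 = 0 := by simp [penaltyDeriv]

theorem abs_penaltyDeriv_sub_le (x y : ℝ) : |penaltyDeriv x - penaltyDeriv y| ≤ |x - y| := by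
  unfold penaltyDeriv
  rw [neg_sub_neg]
  refine (abs_max_zero_sub_le _ _).trans (le_of_eq ?_)
  rw [neg_sub_neg]

/-- Whatever the value of a coordinate below `1`, the gate and the penalty together push it
upwards. -/
theorem quarter_le_push {x y : ℝ} (hx : 1 ≤ x) (hy : y < 1) :
    1 / 4 ≤ link x * gateDeriv y - penaltyDeriv y := by
  have h1 := half_le_link hx
  have h2 := gateDeriv_pos y
  have h3 := penaltyDeriv_nonpos y
  -- On `[-1, 1)` the slope of the gate is at least 1/2. Further to the left it fades, and the
  -- penalty takes over.
  rcases le_total (-1) y with h | h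
  · have : 1 / 2 ≤ gateDeriv y := by
      unfold gateDeriv
      rw [div_le_div_iff₀ (by norm_num) (by positivity)]
      nlinarith
    nlinarith
  · have : penaltyDeriv y ≤ -1 := by
      unfold penaltyDeriv
      have : 1 ≤ max (-y) 0 := le_max_of_le_left (by linarith)
      linarith
    nlinarith [mul_pos (by linarith : 0 < link x) h2]

theorem continuous_link : Continuous link :=
  continuous_iff_continuousAt.2 fun x => (hasDerivAt_link x).continuousAt

theorem continuous_gate : Continuous gate :=
  continuous_iff_continuousAt.2 fun x => (hasDerivAt_gate x).continuousAt

theorem continuous_linkDeriv : Continuous linkDeriv := by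
  unfold linkDeriv
  exact (continuous_const.mul (continuous_id.max continuous_const)).div (by fun_prop)
    fun x => by positivity

theorem continuous_gateDeriv : Continuous gateDeriv := by
  unfold gateDeriv
  exact continuous_const.div (by fun_prop) fun x => by positivity

theorem continuous_penaltyDeriv : Continuous penaltyDeriv := by
  unfold penaltyDeriv; fun_prop

/-! ### The hard function: a chain of coordinates -/

section Chain

variable {d : ℕ}

/-- The values along the chain: a constant `1`, followed by the coordinates `e 0, …, e (T - 1)`. -/
noncomputable def chainVal (T : ℕ) (e : ℕ → Fin d) (x : Vec d) : ℕ → ℝ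
  | 0 => 1
  -- Indices are shifted by one: link `m` joins the values `m` and `m + 1`, so it is the link that
  -- reveals `e m`. The value 0 past the end only serves to make the function total.
  | m + 1 => if m < T then x (e m) else 0

/-- The gradients of the values along the chain. -/
noncomputable def chainDir (T : ℕ) (e : ℕ → Fin d) : ℕ → Vec d
  | 0 => 0
  | m + 1 => if m < T then EuclideanSpace.single (e m) 1 else 0

/-- The derivative of a link with respect to its first argument. -/
noncomputable def pull (X : ℕ → ℝ) (m : ℕ) : ℝ := -(linkDeriv (X m) * gate (X (m + 1)))

/-- The derivative of a link with respect to its second argument. -/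
noncomputable def push (X : ℕ → ℝ) (m : ℕ) : ℝ :=
  penaltyDeriv (X (m + 1)) - link (X m) * gateDeriv (X (m + 1))

/-- The weighted sum of the links of the chain. -/
noncomputable def chainSum (T : ℕ) (e : ℕ → Fin d) (W : ℕ → ℝ) (x : Vec d) : ℝ :=
  ∑ m ∈ Finset.range T, W m * (penalty (chainVal T e x (m + 1)) -
    link (chainVal T e x m) * gate (chainVal T e x (m + 1)))

/-- The gradient of `chainSum`. -/
noncomputable def chainGrad (T : ℕ) (e : ℕ → Fin d) (W : ℕ → ℝ) (x : Vec d) : Vec d :=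
  ∑ m ∈ Finset.range T, W m • (pull (chainVal T e x) m • chainDir T e m +
    push (chainVal T e x) m • chainDir T e (m + 1))

theorem hasFDerivAt_chainVal (T : ℕ) (e : ℕ → Fin d) (m : ℕ) (x : Vec d) :
    HasFDerivAt (fun y => chainVal T e y m) (innerSL ℝ (chainDir T e m)) x := by
  cases m with
  | zero => simpa [chainVal, chainDir] using hasFDerivAt_const (1 : ℝ) x
  | succ m =>
    by_cases h : m < T
    · simp only [chainVal, chainDir, if_pos h]
      have h1 : innerSL ℝ (EuclideanSpace.single (e m) (1 : ℝ)) =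
          (EuclideanSpace.proj (e m) : Vec d →L[ℝ] ℝ) := by
        ext y
        simp [EuclideanSpace.inner_single_left]
      rw [h1]
      exact (EuclideanSpace.proj (e m) : Vec d →L[ℝ] ℝ).hasFDerivAt
    · simpa [chainVal, chainDir, h] using hasFDerivAt_const (0 : ℝ) x

theorem hasGradientAt_chainSum (T : ℕ) (e : ℕ → Fin d) (W : ℕ → ℝ) (x : Vec d) :
    HasGradientAt (chainSum T e W) (chainGrad T e W x) x := by
  rw [hasGradientAt_iff_hasFDerivAt]
  have key : ∀ m ∈ Finset.range T, HasFDerivAt (fun y : Vec d =>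
      W m * (penalty (chainVal T e y (m + 1)) -
        link (chainVal T e y m) * gate (chainVal T e y (m + 1))))
      (innerSL ℝ (W m • (pull (chainVal T e x) m • chainDir T e m +
        push (chainVal T e x) m • chainDir T e (m + 1)))) x := by
    intro m _
    have h1 := (hasDerivAt_penalty _).comp_hasFDerivAt x (hasFDerivAt_chainVal T e (m + 1) x)
    have h2 := (hasDerivAt_link _).comp_hasFDerivAt x (hasFDerivAt_chainVal T e m x)
    have h3 := (hasDerivAt_gate _).comp_hasFDerivAt x (hasFDerivAt_chainVal T e (m + 1) x)
    refine ((h1.sub (h2.mul h3)).const_mul (W m)).congr_fderiv ?_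
    ext y
    simp only [map_smul, map_add, pull, push]
    simp
    ring
  refine (HasFDerivAt.fun_sum key).congr_fderiv ?_
  rw [chainGrad, ← map_sum]
  ext y
  simp

theorem chainDir_apply {T : ℕ} {e : ℕ → Fin d} (he : Set.InjOn e (Set.Iio T)) {k : ℕ} (hk : k < T)
    (m : ℕ) : chainDir T e m (e k) = if m = k + 1 then 1 else 0 := by
  cases m with
  | zero => simp [chainDir]
  | succ m =>
    by_cases h : m < T
    · have h1 : e k = e m ↔ m = k := ⟨fun h' => (he hk h h').symm, fun h' => by rw [h']⟩
      simp [chainDir, h, h1]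
    · have : m ≠ k := by omega
      simp [chainDir, h, this]

theorem chainDir_apply_of_notMem {T : ℕ} {e : ℕ → Fin d} {ν : Fin d} (hν : ∀ k < T, e k ≠ ν)
    (m : ℕ) : chainDir T e m ν = 0 := by
  cases m with
  | zero => simp [chainDir]
  | succ m =>
    by_cases h : m < T
    · simp [chainDir, h, (hν m h).symm]
    · simp [chainDir, h]

theorem chainGrad_apply_of_notMem {T : ℕ} {e : ℕ → Fin d} {ν : Fin d} (hν : ∀ k < T, e k ≠ ν)
    (W : ℕ → ℝ) (x : Vec d) : chainGrad T e W x ν = 0 := by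
  simp [chainGrad, chainDir_apply_of_notMem hν]

theorem chainGrad_apply {T : ℕ} {e : ℕ → Fin d} (he : Set.InjOn e (Set.Iio T)) {k : ℕ} (hk : k < T)
    (W : ℕ → ℝ) (x : Vec d) :
    chainGrad T e W x (e k) = W k * push (chainVal T e x) k +
      if k + 1 < T then W (k + 1) * pull (chainVal T e x) (k + 1) else 0 := by
  simp [chainGrad, chainDir_apply he hk, Finset.sum_add_distrib, hk]
  ring

/-! ### Smoothness of the chain, its range, and the size of its gradient. -/

theorem chainVal_succ {T : ℕ} (e : ℕ → Fin d) (x : Vec d) {k : ℕ} (hk : k < T) :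
    chainVal T e x (k + 1) = x (e k) := by simp [chainVal, hk]

/-- The initial constant cancels, and by injectivity of `e` the other terms are distinct entries of
`x - y`. -/
theorem sum_chainVal_sub_sq_le {T : ℕ} {e : ℕ → Fin d} (he : Set.InjOn e (Set.Iio T)) (x y : Vec d)
    (N : ℕ) : ∑ m ∈ Finset.range N, (chainVal T e x m - chainVal T e y m) ^ 2 ≤ ‖x - y‖ ^ 2 := by
  have h1 : ∑ m ∈ Finset.range (N + 1), (chainVal T e x m - chainVal T e y m) ^ 2 ≤
      ‖x - y‖ ^ 2 := by
    rw [Finset.sum_range_succ']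
    have h2 : ∀ m, (chainVal T e x (m + 1) - chainVal T e y (m + 1)) ^ 2 =
        if m < T then (x (e m) - y (e m)) ^ 2 else 0 := by
      intro m; by_cases h : m < T <;> simp [chainVal, h]
    simp only [h2]
    rw [← Finset.sum_filter, EuclideanSpace.norm_sq_eq]
    have h3 : Set.InjOn e ((Finset.range N).filter (· < T)) :=
      he.mono fun m hm => (Finset.mem_filter.1 hm).2
    have h4 := Finset.sum_image (f := fun ν => (x ν - y ν) ^ 2) h3
    rw [← h4]
    simp only [chainVal, sub_self, ne_eq, OfNat.ofNat_ne_zero, not_false_eq_true, zero_pow,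
      add_zero, Real.norm_eq_abs, sq_abs, PiLp.sub_apply]
    exact Finset.sum_le_sum_of_subset_of_nonneg (Finset.subset_univ _) fun _ _ _ => sq_nonneg _
  exact (Finset.sum_le_sum_of_subset_of_nonneg (Finset.range_mono (Nat.le_succ N))
    fun _ _ _ => sq_nonneg _).trans h1

theorem sum_chainVal_shift_sub_sq_le {T : ℕ} {e : ℕ → Fin d} (he : Set.InjOn e (Set.Iio T))
    (x y : Vec d) (N j : ℕ) :
    ∑ m ∈ Finset.range N, (chainVal T e x (m + j) - chainVal T e y (m + j)) ^ 2 ≤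
      ‖x - y‖ ^ 2 := by
  refine le_trans ?_ (sum_chainVal_sub_sq_le he x y (N + j))
  rw [Finset.range_eq_Ico, Finset.sum_Ico_add' (fun m => (chainVal T e x m - chainVal T e y m) ^ 2)]
  refine Finset.sum_le_sum_of_subset_of_nonneg (fun m hm => ?_) fun _ _ _ => sq_nonneg _
  simp only [Finset.mem_Ico, Finset.mem_range] at hm ⊢
  omega

theorem norm_sq_eq_sum_chain {T : ℕ} {e : ℕ → Fin d} (he : Set.InjOn e (Set.Iio T)) {v : Vec d}
    (hv : ∀ ν, (∀ k < T, e k ≠ ν) → v ν = 0) :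
    ‖v‖ ^ 2 = ∑ k ∈ Finset.range T, v (e k) ^ 2 := by
  have h3 : Set.InjOn e (Finset.range T) := he.mono fun m hm => Finset.mem_range.1 hm
  rw [EuclideanSpace.norm_sq_eq, ← Finset.sum_image (f := fun ν => v ν ^ 2) h3]
  simp only [Real.norm_eq_abs, sq_abs]
  refine (Finset.sum_subset (Finset.subset_univ _) fun ν _ hν => ?_).symm
  rw [hv ν fun k hk h => hν (Finset.mem_image.2 ⟨k, Finset.mem_range.2 hk, h⟩)]
  simp

/-- Product rule for differences: 16 is the bound 4 of `gate` times the Lipschitz constant 4 of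
`linkDeriv`, and 2 is the bound of `linkDeriv` times the Lipschitz constant 1 of `gate`. -/
theorem abs_pull_sub_le (X Y : ℕ → ℝ) (m : ℕ) :
    |pull X m - pull Y m| ≤ 16 * |X m - Y m| + 2 * |X (m + 1) - Y (m + 1)| := by
  have h := abs_mul_sub_mul_le (linkDeriv_le (X m)) (abs_gate_le (Y (m + 1)))
    (abs_linkDeriv_sub_le (X m) (Y m)) (abs_gate_sub_le (X (m + 1)) (Y (m + 1)))
  unfold pull
  rw [neg_sub_neg, abs_sub_comm]
  linarith

theorem abs_push_sub_le (X Y : ℕ → ℝ) (m : ℕ) :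
    |push X m - push Y m| ≤ 2 * |X m - Y m| + 2 * |X (m + 1) - Y (m + 1)| := by
  have h := abs_mul_sub_mul_le
    (show |link (X m)| ≤ 1 by rw [abs_of_nonneg (link_nonneg _)]; exact link_le_one _)
    (abs_gateDeriv_le (Y (m + 1)))
    (abs_link_sub_le (X m) (Y m)) (abs_gateDeriv_sub_le (X (m + 1)) (Y (m + 1)))
  have h2 := abs_penaltyDeriv_sub_le (X (m + 1)) (Y (m + 1))
  unfold push
  rw [sub_sub_sub_comm]
  refine (abs_sub _ _).trans ?_
  linarith

/-- The gradient of the unweighted chain is Lipschitz, with a universal constant. -/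
theorem norm_chainGrad_sub_le {T : ℕ} {e : ℕ → Fin d} (he : Set.InjOn e (Set.Iio T))
    (x y : Vec d) : ‖chainGrad T e 1 x - chainGrad T e 1 y‖ ≤ 60 * ‖x - y‖ := by
  set X := chainVal T e x
  set Y := chainVal T e y
  refine abs_le_of_sq_le_sq' ?_ (by positivity) |>.2
  rw [norm_sq_eq_sum_chain he fun ν hν => by
    simp [chainGrad_apply_of_notMem hν]]
  -- The gradient is tridiagonal. Its entry at `e k` varies by at most 20 times the sum of three
  -- differences, and squaring gives `3 * 20 ^ 2 = 1200`. The three shifted sums then add up to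
  -- `3600 = 60 ^ 2`.
  have h1 : ∀ k ∈ Finset.range T, (chainGrad T e 1 x - chainGrad T e 1 y) (e k) ^ 2 ≤
      1200 * (X k - Y k) ^ 2 + 1200 * (X (k + 1) - Y (k + 1)) ^ 2 +
        1200 * (X (k + 2) - Y (k + 2)) ^ 2 := by
    intro k hk
    have hk' := Finset.mem_range.1 hk
    rw [PiLp.sub_apply, chainGrad_apply he hk', chainGrad_apply he hk']
    have ha := abs_push_sub_le X Y k
    have hb := abs_pull_sub_le X Y (k + 1)
    have h2 : |(1 : ℕ → ℝ) k * push X k + (if k + 1 < T then (1 : ℕ → ℝ) (k + 1) * pull X (k + 1)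
        else 0) - ((1 : ℕ → ℝ) k * push Y k + if k + 1 < T then (1 : ℕ → ℝ) (k + 1) *
          pull Y (k + 1) else 0)| ≤
        20 * (|X k - Y k| + |X (k + 1) - Y (k + 1)| + |X (k + 2) - Y (k + 2)|) := by
      have e1 := abs_nonneg (X k - Y k)
      have e2 := abs_nonneg (X (k + 1) - Y (k + 1))
      have e3 := abs_nonneg (X (k + 2) - Y (k + 2))
      rw [add_sub_add_comm]
      refine (abs_add_le _ _).trans ?_
      split_ifs
      · simp only [Pi.one_apply, one_mul]; linarith
      · simp only [Pi.one_apply, one_mul, sub_zero, abs_zero]; linarith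
    have h3 := pow_le_pow_left₀ (abs_nonneg _) h2 2
    rw [sq_abs] at h3
    refine h3.trans ?_
    rw [← sq_abs (X k - Y k), ← sq_abs (X (k + 1) - Y (k + 1)), ← sq_abs (X (k + 2) - Y (k + 2))]
    generalize |X k - Y k| = p
    generalize |X (k + 1) - Y (k + 1)| = q
    generalize |X (k + 2) - Y (k + 2)| = r
    nlinarith [sq_nonneg (p - q), sq_nonneg (p - r), sq_nonneg (q - r)]
  refine (Finset.sum_le_sum h1).trans ?_
  rw [Finset.sum_add_distrib, Finset.sum_add_distrib, ← Finset.mul_sum, ← Finset.mul_sum,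
    ← Finset.mul_sum]
  have s0 := sum_chainVal_shift_sub_sq_le he x y T 0
  have s1 := sum_chainVal_shift_sub_sq_le he x y T 1
  have s2 := sum_chainVal_shift_sub_sq_le he x y T 2
  simp only [add_zero] at s0
  linarith

/-- The penalty is nonnegative and `link * gate` is at most 4. With `chainSum_zero_le` this bounds
the gap at the origin by `4 * T`. -/
theorem neg_le_chainSum (T : ℕ) (e : ℕ → Fin d) (x : Vec d) :
    -(4 * T) ≤ chainSum T e 1 x := by
  have h : ∀ m ∈ Finset.range T, (-4 : ℝ) ≤ (1 : ℕ → ℝ) m * (penalty (chainVal T e x (m + 1)) -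
      link (chainVal T e x m) * gate (chainVal T e x (m + 1))) := by
    intro m _
    have h1 := penalty_nonneg (chainVal T e x (m + 1))
    have h2 := mul_le_mul (link_le_one (chainVal T e x m)) (gate_le_four (chainVal T e x (m + 1)))
      (gate_pos _).le zero_le_one
    simp only [Pi.one_apply, one_mul]
    linarith
  have := Finset.sum_le_sum h
  simp only [Finset.sum_const, Finset.card_range, nsmul_eq_mul] at this
  unfold chainSum
  linarith

theorem chainSum_zero_le (T : ℕ) (e : ℕ → Fin d) : chainSum T e 1 0 ≤ 0 := by
  refine Finset.sum_nonpos fun m _ => ?_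
  have h1 : chainVal T e 0 (m + 1) = 0 := by simp [chainVal]
  rw [h1, penalty_zero]
  have := mul_nonneg (link_nonneg (chainVal T e 0 m)) (gate_pos 0).le
  simp only [Pi.one_apply, one_mul]
  linarith

/-- The gradient is large as long as the last coordinate of the chain has not been reached. -/
theorem quarter_le_norm_chainGrad {T : ℕ} {e : ℕ → Fin d} (he : Set.InjOn e (Set.Iio T))
    (hT : 0 < T) {x : Vec d} (hx : x (e (T - 1)) = 0) : 1 / 4 ≤ ‖chainGrad T e 1 x‖ := by
  set X := chainVal T e x with hX
  have hlast : X T < 1 := by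
    obtain ⟨k, rfl⟩ : ∃ k, T = k + 1 := ⟨T - 1, by omega⟩
    rw [hX, chainVal_succ e x (Nat.lt_succ_self k)]
    rw [Nat.add_sub_cancel] at hx
    rw [hx]; exact one_pos
  -- The values start at 1 and end below 1, so somewhere they drop below 1; the gradient is large at
  -- that link.
  obtain ⟨k, hk, h1, h2⟩ : ∃ k < T, 1 ≤ X k ∧ X (k + 1) < 1 := by
    by_contra hcon
    push Not at hcon
    have : ∀ k ≤ T, 1 ≤ X k := by
      intro k
      induction k with
      | zero => intro _; exact le_refl _
      | succ k ih => intro hk; exact hcon k hk (ih (by omega))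
    exact absurd (this T le_rfl) (not_le.2 hlast)
  have h3 := quarter_le_push h1 h2
  have h4 : chainGrad T e 1 x (e k) ≤ -(1 / 4) := by
    rw [chainGrad_apply he hk]
    -- The neighbouring link contributes with the same sign, so it cannot cancel the push.
    have h5 := mul_nonneg (linkDeriv_nonneg (X (k + 1))) (gate_pos (X (k + 2))).le
    change (1 : ℕ → ℝ) k * (penaltyDeriv (X (k + 1)) - link (X k) * gateDeriv (X (k + 1))) +
      (if k + 1 < T then (1 : ℕ → ℝ) (k + 1) * (-(linkDeriv (X (k + 1)) * gate (X (k + 2)))) else 0)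
        ≤ _
    simp only [Pi.one_apply, one_mul]
    split_ifs <;> linarith
  have h6 := PiLp.norm_apply_le (chainGrad T e 1 x) (e k)
  rw [Real.norm_eq_abs] at h6
  have := neg_abs_le (chainGrad T e 1 x (e k))
  linarith

/-- If the entry `x (e k)` is zero, then `penaltyDeriv` and `linkDeriv` vanish there. What remains
is the link `k`, which needs its weight and the preceding value to be nonzero. -/
theorem chainGrad_apply_ne_zero {T : ℕ} {e : ℕ → Fin d} (he : Set.InjOn e (Set.Iio T)) {k : ℕ}
    (hk : k < T) {W : ℕ → ℝ} {x : Vec d} (h : chainGrad T e W x (e k) ≠ 0) :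
    x (e k) ≠ 0 ∨ W k ≠ 0 ∧ chainVal T e x k ≠ 0 := by
  by_contra! hcon
  refine h ?_
  have h1 : chainVal T e x (k + 1) = 0 := by rw [chainVal_succ e x hk, hcon.1]
  rw [chainGrad_apply he hk, pull, push, h1, penaltyDeriv_zero, linkDeriv_zero]
  by_cases hW : W k = 0
  · simp [hW]
  · simp [hcon.2 hW, link_of_nonpos le_rfl]

open Classical in
/-- The part of the gradient that discovers a new coordinate of the chain. -/
noncomputable def freshPart (T : ℕ) (e : ℕ → Fin d) (W : ℕ → ℝ) (x : Vec d) : Vec d :=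
  ∑ k ∈ Finset.range T, (if ∀ j, k ≤ j → j < T → x (e j) = 0 then
    -(W k * link (chainVal T e x k)) else 0) • chainDir T e (k + 1)

theorem freshPart_apply_of_notMem {T : ℕ} {e : ℕ → Fin d} {ν : Fin d} (hν : ∀ k < T, e k ≠ ν)
    (W : ℕ → ℝ) (x : Vec d) : freshPart T e W x ν = 0 := by
  simp [freshPart, chainDir_apply_of_notMem hν, -ite_smul]

open Classical in
theorem freshPart_apply {T : ℕ} {e : ℕ → Fin d} (he : Set.InjOn e (Set.Iio T)) {k : ℕ} (hk : k < T)
    (W : ℕ → ℝ) (x : Vec d) :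
    freshPart T e W x (e k) = if ∀ j, k ≤ j → j < T → x (e j) = 0 then
      -(W k * link (chainVal T e x k)) else 0 := by
  simp [freshPart, chainDir_apply he hk, hk, -ite_smul]

/-- At most one entry is nonzero: if all coordinates from `e a` on vanish, then for `b > a` the
value preceding `e b` is 0 and its link vanishes. Hence the variance of the noise does not grow with
the length of the chain. -/
theorem norm_sq_freshPart_le {T : ℕ} {e : ℕ → Fin d} (he : Set.InjOn e (Set.Iio T)) {W : ℕ → ℝ}
    {B : ℝ} (hB : ∀ k, W k ^ 2 ≤ B) (x : Vec d) : ‖freshPart T e W x‖ ^ 2 ≤ B := by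
  rw [norm_sq_eq_sum_chain he fun ν hν => freshPart_apply_of_notMem hν W x]
  by_cases h : ∃ k < T, freshPart T e W x (e k) ≠ 0
  · obtain ⟨k, hk, h⟩ := h
    have unique : ∀ k' < T, k' ≠ k → freshPart T e W x (e k') = 0 := by
      have aux : ∀ a b, a < b → b < T → freshPart T e W x (e a) ≠ 0 →
          freshPart T e W x (e b) = 0 := by
        intro a b hab hb ha
        rw [freshPart_apply he (hab.trans hb)] at ha
        have h1 : ∀ j, a ≤ j → j < T → x (e j) = 0 := by
          by_contra hcon; exact ha (if_neg hcon)
        obtain ⟨b, rfl⟩ : ∃ c, b = c + 1 := ⟨b - 1, by omega⟩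
        have h2 : chainVal T e x (b + 1) = 0 := by
          rw [chainVal_succ e x (by omega)]; exact h1 b (by omega) (by omega)
        rw [freshPart_apply he hb, h2, link_of_nonpos le_rfl]
        simp
      intro k' hk' hne
      rcases lt_or_gt_of_ne hne with hlt | hlt
      · by_contra hcon; exact h (aux k' k hlt hk hcon)
      · exact aux k k' hlt hk' h
    rw [Finset.sum_eq_single k (fun k' hk' hne => by
      rw [unique k' (Finset.mem_range.1 hk') hne]; simp) fun hn => absurd (Finset.mem_range.2 hk) hn]
    rw [freshPart_apply he hk]
    split_ifs
    · have h1 := link_nonneg (chainVal T e x k)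
      have h2 := link_le_one (chainVal T e x k)
      have h3 := hB k
      have h4 := sq_nonneg (W k)
      have h5 : link (chainVal T e x k) ^ 2 ≤ 1 := by nlinarith
      calc _ = W k ^ 2 * link (chainVal T e x k) ^ 2 := by ring
        _ ≤ B := by nlinarith
    · have h3 := hB k
      nlinarith [sq_nonneg (W k)]
  · push Not at h
    rw [Finset.sum_eq_zero fun k hk => by rw [h k (Finset.mem_range.1 hk)]; simp]
    exact (sq_nonneg _).trans (hB 0)

/-- A stochastic gradient discovers at most the next coordinate of the chain, and it discovers
nothing when its fresh part is switched off. -/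
theorem noisyGrad_apply_ne_zero {T : ℕ} {e : ℕ → Fin d} (he : Set.InjOn e (Set.Iio T)) {k N : ℕ}
    (hk : k < T) {W : ℕ → ℝ} {x : Vec d} {s : ℝ} (hN : ∀ j < T, x (e j) ≠ 0 → j < N)
    (h : (chainGrad T e W x + s • freshPart T e W x) (e k) ≠ 0) :
    k < N ∨ k ≤ N ∧ s ≠ -1 := by
  by_contra! hcon
  have h1 : ∀ j, k ≤ j → j < T → x (e j) = 0 := by
    intro j hj hjT
    by_contra h2
    exact absurd (hN j hjT h2) (by omega)
  have h2 : chainVal T e x (k + 1) = 0 := by rw [chainVal_succ e x hk, h1 k le_rfl hk]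
  refine h ?_
  rw [PiLp.add_apply, PiLp.smul_apply, chainGrad_apply he hk, freshPart_apply he hk, if_pos h1,
    pull, push, h2, penaltyDeriv_zero, linkDeriv_zero, gateDeriv_zero]
  -- Beyond `N` the preceding value is 0 and both parts vanish. At `k = N` the gradient entry is
  -- exactly the fresh part, because `gateDeriv 0 = 1`, and the factor `-1` cancels it.
  rcases hcon.1.lt_or_eq with hlt | heq
  · obtain ⟨k, rfl⟩ : ∃ c, k = c + 1 := ⟨k - 1, by omega⟩
    have h3 : chainVal T e x (k + 1) = 0 := by
      rw [chainVal_succ e x (by omega)]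
      by_contra h4
      exact absurd (hN k (by omega) h4) (by omega)
    rw [h3, link_of_nonpos le_rfl]
    simp
  · rw [hcon.2 heq.ge]
    simp

theorem continuous_chainVal (T : ℕ) (e : ℕ → Fin d) (m : ℕ) :
    Continuous fun x => chainVal T e x m :=
  continuous_iff_continuousAt.2 fun x => (hasFDerivAt_chainVal T e m x).continuousAt

theorem continuous_chainGrad (T : ℕ) (e : ℕ → Fin d) (W : ℕ → ℝ) : Continuous (chainGrad T e W) := by
  have h := continuous_chainVal T e
  refine continuous_finsetSum _ fun m _ => Continuous.fun_const_smul (Continuous.fun_add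
    (Continuous.fun_smul ?_ continuous_const) (Continuous.fun_smul ?_ continuous_const)) _
  · exact ((continuous_linkDeriv.comp (h _)).mul (continuous_gate.comp (h _))).neg
  · exact (continuous_penaltyDeriv.comp (h _)).sub
      ((continuous_link.comp (h _)).mul (continuous_gateDeriv.comp (h _)))

theorem measurable_freshPart (T : ℕ) (e : ℕ → Fin d) (W : ℕ → ℝ) : Measurable (freshPart T e W) := by
  refine Finset.measurable_sum _ fun k _ => Measurable.smul_const (Measurable.ite ?_ ?_ ?_) _
  · have : {x : Vec d | ∀ j, k ≤ j → j < T → x (e j) = 0} =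
        ⋂ j, ⋂ (_ : k ≤ j), ⋂ (_ : j < T), {x : Vec d | x (e j) = 0} := by
      ext x; simp
    rw [this]
    refine MeasurableSet.iInter fun j => MeasurableSet.iInter fun _ => MeasurableSet.iInter fun _ => ?_
    exact measurableSet_eq_fun (by fun_prop) measurable_const
  · exact ((continuous_link.comp (continuous_chainVal T e k)).measurable.const_mul _).neg
  · exact measurable_const

end Chain

/-! ### The hard problem and its oracle -/

/-- Centred multiplicative noise: with probability `p` it equals `1 / p - 1`, otherwise `-1`. -/
noncomputable def bernoulliNoise (p : ℝ) (ξ : unitInterval) : ℝ :=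
  (Set.indicator {ξ : unitInterval | (ξ : ℝ) ≤ p} (fun _ => 1 / p) ξ) - 1

theorem measurableSet_unitInterval_le (p : ℝ) :
    MeasurableSet {ξ : unitInterval | (ξ : ℝ) ≤ p} :=
  measurableSet_le measurable_subtype_coe measurable_const

theorem volume_unitInterval_le {p : ℝ} (h0 : 0 ≤ p) (h1 : p ≤ 1) :
    volume {ξ : unitInterval | (ξ : ℝ) ≤ p} = ENNReal.ofReal p :=
  unitInterval.volume_Iic ⟨p, h0, h1⟩

theorem measurable_bernoulliNoise (p : ℝ) : Measurable (bernoulliNoise p) :=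
  (measurable_const.indicator (measurableSet_unitInterval_le p)).sub_const _

theorem bernoulliNoise_ne {p : ℝ} {ξ : unitInterval} (h : bernoulliNoise p ξ ≠ -1) :
    (ξ : ℝ) ≤ p := by
  by_contra hcon
  refine h ?_
  simp [bernoulliNoise, Set.indicator, hcon]

theorem bernoulliNoise_one (ξ : unitInterval) : bernoulliNoise 1 ξ = 0 := by
  simp [bernoulliNoise, Set.indicator, ξ.2.2]

theorem integral_indicator_unitInterval {p : ℝ} (h0 : 0 ≤ p) (h1 : p ≤ 1) (c : ℝ) :
    ∫ ξ : unitInterval, Set.indicator {ξ : unitInterval | (ξ : ℝ) ≤ p} (fun _ => c) ξ = p * c := by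
  rw [integral_indicator_const _ (measurableSet_unitInterval_le p), measureReal_def,
    volume_unitInterval_le h0 h1, ENNReal.toReal_ofReal h0, smul_eq_mul]

theorem integrable_indicator_unitInterval (p c : ℝ) :
    Integrable (Set.indicator {ξ : unitInterval | (ξ : ℝ) ≤ p} (fun _ => c)) :=
  (integrable_const c).indicator (measurableSet_unitInterval_le p)

theorem integrable_bernoulliNoise (p : ℝ) : Integrable (bernoulliNoise p) :=
  (integrable_indicator_unitInterval p _).sub (integrable_const _)

theorem integral_bernoulliNoise {p : ℝ} (h0 : 0 < p) (h1 : p ≤ 1) :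
    ∫ ξ, bernoulliNoise p ξ = 0 := by
  unfold bernoulliNoise
  rw [integral_sub (integrable_indicator_unitInterval p _) (integrable_const _),
    integral_indicator_unitInterval h0.le h1]
  simp [h0.ne']

theorem bernoulliNoise_sq (p : ℝ) (ξ : unitInterval) : bernoulliNoise p ξ ^ 2 =
    Set.indicator {ξ : unitInterval | (ξ : ℝ) ≤ p} (fun _ => 1 / p ^ 2 - 2 / p) ξ + 1 := by
  by_cases h : (ξ : ℝ) ≤ p
  · simp [bernoulliNoise, Set.indicator, h]; ring
  · simp [bernoulliNoise, Set.indicator, h]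

theorem integrable_bernoulliNoise_sq (p : ℝ) : Integrable fun ξ => bernoulliNoise p ξ ^ 2 := by
  simp only [bernoulliNoise_sq]
  exact (integrable_indicator_unitInterval p _).add (integrable_const _)

theorem integral_bernoulliNoise_sq {p : ℝ} (h0 : 0 < p) (h1 : p ≤ 1) :
    ∫ ξ, bernoulliNoise p ξ ^ 2 = 1 / p - 1 := by
  simp only [bernoulliNoise_sq]
  rw [integral_add (integrable_indicator_unitInterval p _) (integrable_const _),
    integral_indicator_unitInterval h0.le h1]
  simp
  field_simp
  ring

section Problem

variable {n d : ℕ}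

theorem hasGradientAt_scaled {f : Vec d → ℝ} {g x : Vec d} {c : ℝ} (a : ℝ)
    (h : HasGradientAt f g (c • x)) : HasGradientAt (fun y => a * f (c • y)) ((a * c) • g) x := by
  rw [hasGradientAt_iff_hasFDerivAt] at h ⊢
  have h1 : HasFDerivAt (fun y : Vec d => c • y) (c • ContinuousLinearMap.id ℝ (Vec d)) x :=
    (hasFDerivAt_id x).const_smul c
  refine ((h.comp x h1).const_mul a).congr_fderiv ?_
  ext y
  simp
  ring

theorem hasGradientAt_scaled_chainSum (T : ℕ) (e : ℕ → Fin d) (a c : ℝ) (W : ℕ → ℝ) (x : Vec d) :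
    HasGradientAt (fun y => a * chainSum T e W (c • y)) ((a * c) • chainGrad T e W (c • x)) x :=
  hasGradientAt_scaled a (hasGradientAt_chainSum T e W (c • x))

/-- The chain is distributed over the workers: worker `i` holds the link `m` with the
weight `W i m`, and each of its samples shows the fresh part of the gradient with
probability `p i`. -/
noncomputable def chainProblem (T : ℕ) (e : ℕ → Fin d) (he : Set.InjOn e (Set.Iio T)) (a c σ2 : ℝ)
    (W : Fin n → ℕ → ℝ) (B p : Fin n → ℝ) (hW : ∀ i m, W i m ^ 2 ≤ B i) (hp0 : ∀ i, 0 < p i)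
    (hp1 : ∀ i, p i ≤ 1) (hvar : ∀ i, (a * c) ^ 2 * B i * (1 / p i - 1) ≤ σ2) :
    HeterogeneousProblem n d σ2 where
  f i x := a * chainSum T e (W i) (c • x)
  differentiable i x := (hasGradientAt_scaled_chainSum T e a c (W i) x).differentiableAt
  Ξ := unitInterval
  measurableSpace := inferInstance
  D := volume
  isProbabilityMeasure := inferInstance
  grad i x ξ := (a * c) • (chainGrad T e (W i) (c • x) +
    bernoulliNoise (p i) ξ • freshPart T e (W i) (c • x))
  measurable_grad i := by
    have h1 : Measurable fun q : Vec d × unitInterval => c • q.1 := measurable_fst.const_smul c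
    exact (((continuous_chainGrad T e (W i)).measurable.comp h1).add
      (((measurable_bernoulliNoise (p i)).comp measurable_snd).smul
        ((measurable_freshPart T e (W i)).comp h1))).const_smul (a * c)
  integrable_grad i x :=
    ((integrable_const _).add ((integrable_bernoulliNoise (p i)).smul_const _)).fun_smul _
  unbiased i x := by
    rw [(hasGradientAt_scaled_chainSum T e a c (W i) x).gradient, integral_smul,
      integral_add (integrable_const _) ((integrable_bernoulliNoise (p i)).smul_const _),
      integral_smul_const, integral_bernoulliNoise (hp0 i) (hp1 i)]
    simp
  variance_le i x := by
    rw [(hasGradientAt_scaled_chainSum T e a c (W i) x).gradient]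
    have h1 : ∀ ξ : unitInterval, ‖(a * c) • (chainGrad T e (W i) (c • x) +
        bernoulliNoise (p i) ξ • freshPart T e (W i) (c • x)) -
          (a * c) • chainGrad T e (W i) (c • x)‖ ^ 2 =
        (a * c) ^ 2 * ‖freshPart T e (W i) (c • x)‖ ^ 2 * bernoulliNoise (p i) ξ ^ 2 := by
      intro ξ
      rw [← smul_sub, add_sub_cancel_left, norm_smul, norm_smul, mul_pow, mul_pow,
        Real.norm_eq_abs, Real.norm_eq_abs, sq_abs, sq_abs]
      ring
    simp only [h1]
    rw [← ofReal_integral_eq_lintegral_ofReal ((integrable_bernoulliNoise_sq (p i)).const_mul _)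
      (Filter.Eventually.of_forall fun ξ => by positivity), integral_const_mul,
      integral_bernoulliNoise_sq (hp0 i) (hp1 i)]
    refine ENNReal.ofReal_le_ofReal (le_trans ?_ (hvar i))
    have h2 : 0 ≤ 1 / p i - 1 := by
      rw [sub_nonneg, le_div_iff₀ (hp0 i), one_mul]; exact hp1 i
    have h3 := norm_sq_freshPart_le he (hW i) (c • x)
    gcongr

variable {T : ℕ} {e : ℕ → Fin d} {he : Set.InjOn e (Set.Iio T)} {a c σ2 : ℝ}
  {W : Fin n → ℕ → ℝ} {B p : Fin n → ℝ} {hW : ∀ i m, W i m ^ 2 ≤ B i} {hp0 : ∀ i, 0 < p i}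
  {hp1 : ∀ i, p i ≤ 1} {hvar : ∀ i, (a * c) ^ 2 * B i * (1 / p i - 1) ≤ σ2}

theorem objective_chainProblem (hn : 0 < n) (hsum : ∀ m < T, ∑ i, W i m = n) :
    (chainProblem T e he a c σ2 W B p hW hp0 hp1 hvar).objective =
      fun x => a * chainSum T e 1 (c • x) := by
  funext x
  have hn' : (n : ℝ) ≠ 0 := by positivity
  change 1 / (n : ℝ) * ∑ i, a * chainSum T e (W i) (c • x) = _
  rw [← Finset.mul_sum]
  have h1 : ∑ i, chainSum T e (W i) (c • x) = n * chainSum T e 1 (c • x) := by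
    unfold chainSum
    rw [Finset.sum_comm, Finset.mul_sum]
    refine Finset.sum_congr rfl fun m hm => ?_
    rw [← Finset.sum_mul, hsum m (Finset.mem_range.1 hm), Pi.one_apply, one_mul]
  rw [h1]
  field_simp

theorem gradient_objective_chainProblem (hn : 0 < n) (hsum : ∀ m < T, ∑ i, W i m = n) (x : Vec d) :
    gradient (chainProblem T e he a c σ2 W B p hW hp0 hp1 hvar).objective x =
      (a * c) • chainGrad T e 1 (c • x) := by
  rw [objective_chainProblem hn hsum]
  exact (hasGradientAt_scaled_chainSum T e a c 1 x).gradient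

theorem inClass_chainProblem (hn : 0 < n) (hsum : ∀ m < T, ∑ i, W i m = n) {L Δ : ℝ} (ha : 0 < a)
    (hc : 0 < c) (hL : 60 * (a * c ^ 2) ≤ L) (hΔ : 4 * a * T ≤ Δ) :
    InClass Δ L (chainProblem T e he a c σ2 W B p hW hp0 hp1 hvar).objective := by
  have hbound : ∀ x : Vec d, -(4 * a * T) ≤ a * chainSum T e 1 (c • x) := fun x => by
    have := mul_le_mul_of_nonneg_left (neg_le_chainSum T e (c • x)) ha.le
    linarith
  refine ⟨?_, fun x y => ?_, ?_, ?_⟩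
  · rw [objective_chainProblem hn hsum]
    exact fun x => (hasGradientAt_scaled_chainSum T e a c 1 x).differentiableAt
  · rw [gradient_objective_chainProblem hn hsum, gradient_objective_chainProblem hn hsum, ← smul_sub,
      norm_smul, Real.norm_eq_abs, abs_of_pos (mul_pos ha hc)]
    have h1 := norm_chainGrad_sub_le he (c • x) (c • y)
    rw [← smul_sub, norm_smul, Real.norm_eq_abs, abs_of_pos hc] at h1
    calc a * c * ‖chainGrad T e 1 (c • x) - chainGrad T e 1 (c • y)‖
        ≤ a * c * (60 * (c * ‖x - y‖)) := by gcongr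
      _ = 60 * (a * c ^ 2) * ‖x - y‖ := by ring
      _ ≤ L * ‖x - y‖ := by gcongr
  · rw [objective_chainProblem hn hsum]
    exact ⟨_, by rintro _ ⟨x, rfl⟩; exact hbound x⟩
  · rw [objective_chainProblem hn hsum]
    have h1 : -(4 * a * T) ≤ ⨅ x : Vec d, a * chainSum T e 1 (c • x) := le_ciInf hbound
    have h2 := mul_nonpos_of_nonneg_of_nonpos ha.le (chainSum_zero_le T e)
    simp only [smul_zero]
    linarith

theorem le_norm_gradient_chainProblem (hn : 0 < n) (hsum : ∀ m < T, ∑ i, W i m = n) (hT : 0 < T)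
    (ha : 0 < a) (hc : 0 < c) {x : Vec d} (hx : x (e (T - 1)) = 0) : (a * c) ^ 2 / 16 ≤
      ‖gradient (chainProblem T e he a c σ2 W B p hW hp0 hp1 hvar).objective x‖ ^ 2 := by
  rw [gradient_objective_chainProblem hn hsum, norm_smul, Real.norm_eq_abs,
    abs_of_pos (mul_pos ha hc), mul_pow]
  have h1 := quarter_le_norm_chainGrad he hT (x := c • x) (by simp [hx])
  have h2 : 1 / 16 ≤ ‖chainGrad T e 1 (c • x)‖ ^ 2 := by nlinarith
  have := sq_nonneg (a * c)
  nlinarith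

end Problem

/-! ### Propagation of local information -/

section Propagation

variable {n d : ℕ} {env : Environment n} {Ξ : Type} {Z : Type*} [MeasurableSpace Z]
  {A : Algorithm env d Z} {ζ : Z} {g : Fin n → Vec d → Ξ → Vec d} {ξ : Fin n × ℕ → Ξ}

theorem Trace.mem_support_info {r : Trace n d} {S : Schedule env d} {i : Fin n} {t : ℝ≥0}
    {ν : Fin d} : ν ∈ (r.info S g ξ i t).support ↔
      (∃ m, r.start i m + env.h i ≤ t ∧ g i (r.point i m) (ξ (i, m)) ν ≠ 0) ∨
      ∃ i' k, S.dest i' k = i ∧ S.Arrived i' k t ∧ S.decode i' k (r.vec i' k) ν ≠ 0 := by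
  simp only [LocalInfo.support, Set.mem_iUnion, LocalInfo.vectors, supp, Set.mem_ofPred_eq,
    exists_prop]
  constructor
  · rintro ⟨y, ⟨m, c, h⟩ | ⟨i', k, h⟩, hν⟩
    · left
      simp only [Trace.info] at h
      split_ifs at h with h1
      simp only [Option.some.injEq, Prod.mk.injEq] at h
      exact ⟨m, h1, h.2 ▸ hν⟩
    · right
      simp only [Trace.info] at h
      split_ifs at h with h1
      simp only [Option.some.injEq] at h
      exact ⟨i', k, h1.1, h1.2, h ▸ hν⟩
  · rintro (⟨m, h1, h2⟩ | ⟨i', k, h1, h2, h3⟩)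
    · exact ⟨_, Or.inl ⟨m, _, by simp only [Trace.info]; rw [if_pos h1]⟩, h2⟩
    · exact ⟨_, Or.inr ⟨i', k, by simp only [Trace.info]; rw [if_pos ⟨h1, h2⟩]⟩, h3⟩

theorem Schedule.decode_apply_ne_zero {S : Schedule env d} {i : Fin n} {k : ℕ} {s : Vec d}
    {ν : Fin d} (h : S.decode i k s ν ≠ 0) : s ν ≠ 0 ∧ ∃ j < S.size i k, S.idx i k j = ν := by
  rw [Schedule.decode] at h
  simp only [WithLp.ofLp_sum, Finset.sum_apply] at h
  obtain ⟨j, hj, h1⟩ := Finset.exists_ne_zero_of_sum_ne_zero h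
  by_cases h2 : S.idx i k j = ν
  · subst h2
    refine ⟨fun h3 => h1 (by simp [h3]), j, Finset.mem_range.1 hj, rfl⟩
  · exact absurd (by simp [Ne.symm h2]) h1

/-- A property of the known coordinates that is preserved by gradient computations and by
messages holds for all local information. -/
theorem Algorithm.IsExecution.known_induction {r : Trace n d} (hr : A.IsExecution ζ g ξ r)
    (K : Fin n → ℝ≥0 → Fin d → Prop)
    (hgrad : ∀ i m (s t : ℝ≥0) ν, r.start i m = s → s + env.h i ≤ t →
      (∀ μ, r.point i m μ ≠ 0 → K i s μ) → g i (r.point i m) (ξ (i, m)) ν ≠ 0 → K i t ν)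
    (hmsg : ∀ i k (s t : ℝ≥0) j, (A.schedule ζ).sendTime i k = s → (A.schedule ζ).Arrived i k t →
      s ≤ t → j < (A.schedule ζ).size i k → K i s ((A.schedule ζ).idx i k j) →
      K ((A.schedule ζ).dest i k) t ((A.schedule ζ).idx i k j))
    (i : Fin n) (t : ℝ≥0) (ν : Fin d)
    (hν : ν ∈ (r.info (A.schedule ζ) g ξ i t).support) : K i t ν := by
  obtain ⟨δ, hδ, hh, hS⟩ := env.exists_delay
  -- Induction over time slabs of length `δ`: all information available at `t` rests on information
  -- from time `t - δ` or earlier.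
  have key : ∀ N : ℕ, ∀ i (t : ℝ≥0) ν, t < N * δ →
      ν ∈ (r.info (A.schedule ζ) g ξ i t).support → K i t ν := by
    intro N
    induction N with
    | zero => intro i t ν ht; simp at ht
    | succ N ih =>
      intro i t ν ht hν
      have hlt : ∀ s : ℝ≥0, s + δ ≤ t → s < N * δ := by
        intro s hs
        have h1 := hs.trans_lt ht
        rw [Nat.cast_succ, add_mul, one_mul] at h1
        exact lt_of_add_lt_add_right h1
      rcases Trace.mem_support_info.1 hν with ⟨m, h1, h2⟩ | ⟨i', k, h1, h2, h3⟩
      · have hne : r.start i m ≠ ∞ := by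
          intro h; rw [h] at h1; simp at h1
        obtain ⟨s, hs⟩ := (⟨_, ENNReal.coe_toNNReal hne⟩ : ∃ s : ℝ≥0, (s : ℝ≥0∞) = _)
        rw [← hs] at h1
        have h1' : s + env.h i ≤ t := by exact_mod_cast h1
        refine hgrad i m s t ν hs.symm h1' (fun μ hμ => ?_) h2
        refine ih i s μ (hlt s ((add_le_add_right (hh i) s).trans h1')) ?_
        rw [hr.point_eq i m s hs.symm] at hμ
        exact A.supp_point ζ i m _ hμ
      · subst h1
        have h4 := hS (A.schedule ζ) i' k t h2
        have hne : (A.schedule ζ).sendTime i' k ≠ ∞ := by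
          intro h; rw [h] at h4; simp at h4
        obtain ⟨s, hs⟩ := (⟨_, ENNReal.coe_toNNReal hne⟩ : ∃ s : ℝ≥0, (s : ℝ≥0∞) = _)
        rw [← hs] at h4
        have h4' : s + δ ≤ t := by exact_mod_cast h4
        obtain ⟨h5, j, hj, rfl⟩ := Schedule.decode_apply_ne_zero h3
        refine hmsg i' k s t j hs.symm h2 (le_self_add.trans h4') hj (ih i' s _ (hlt s h4') ?_)
        rw [hr.vec_eq i' k s hs.symm] at h5
        exact A.supp_vec ζ i' k _ h5
  obtain ⟨N, hN⟩ := exists_nat_gt (t / δ)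
  exact key N i t ν ((div_lt_iff₀ hδ).1 hN) hν

/-- The computations of one worker do not overlap. Consequently only `⌊t / h i⌋` of its samples can
be complete by time `t`. -/
theorem Algorithm.IsExecution.mul_le_start {r : Trace n d} (hr : A.IsExecution ζ g ξ r)
    (i : Fin n) (m : ℕ) : (m : ℝ≥0∞) * env.h i ≤ r.start i m := by
  have h1 : ∀ m, r.idleFrom env i m ≤ r.start i m := by
    intro m
    rw [hr.start_eq]
    refine le_sInf ?_
    rintro _ ⟨s, rfl, h, _⟩
    exact h
  induction m with
  | zero => simp
  | succ m ih =>
    refine le_trans ?_ (h1 (m + 1))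
    simp only [Trace.idleFrom]
    push_cast
    rw [add_mul, one_mul]
    exact add_le_add_left ih _

/-- If, on a measurable event of probability at least `1 / 2`, no worker knows the coordinate `ν`
by time `t`, and the gradient is large wherever `y ν = 0`, then the expectation is large. -/
theorem Algorithm.lt_expectedInf {σ2 ε : ℝ} (hε : 0 < ε) (A : Algorithm env d Z)
    (P : HeterogeneousProblem n d σ2) (t : ℝ≥0) (ν : Fin d)
    (hP : ∀ y : Vec d, y ν = 0 → 4 * ε ≤ ‖gradient P.objective y‖ ^ 2)
    (G : Set (Z × (Fin n × ℕ → P.Ξ))) (hG : MeasurableSet G)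
    (hhalf : 1 / 2 ≤ (A.seedLaw.prod (Measure.infinitePi fun _ : Fin n × ℕ => P.D)) G)
    (hunknown : ∀ ω ∈ G, ∀ i, ν ∉
      ((A.run ω.1 P.grad ω.2).info (A.schedule ω.1) P.grad ω.2 i t).support) :
    ENNReal.ofReal ε < A.expectedInf P t := by
  have h1 : ∫⁻ ω, G.indicator (fun _ => ENNReal.ofReal (4 * ε)) ω
      ∂(A.seedLaw.prod (Measure.infinitePi fun _ : Fin n × ℕ => P.D)) ≤ A.expectedInf P t := by
    refine lintegral_mono fun ω => ?_
    by_cases hω : ω ∈ G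
    · rw [Set.indicator_of_mem hω]
      refine le_iInf fun y => le_iInf fun hy => ENNReal.ofReal_le_ofReal (hP y ?_)
      obtain ⟨i, hi⟩ := hy
      by_contra hne
      exact hunknown ω hω i (hi hne)
    · rw [Set.indicator_of_notMem hω]; exact zero_le
  rw [lintegral_indicator_const hG] at h1
  refine lt_of_lt_of_le ?_ h1
  -- Asking for `4 * ε` on the event leaves `2 * ε` after the factor 1/2, hence the strict
  -- inequality.
  calc ENNReal.ofReal ε < ENNReal.ofReal (2 * ε) :=
        (ENNReal.ofReal_lt_ofReal_iff (by positivity)).2 (by linarith)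
    _ = ENNReal.ofReal (4 * ε) * (1 / 2) := by
        rw [show (1 / 2 : ℝ≥0∞) = ENNReal.ofReal (1 / 2) by
          rw [ENNReal.ofReal_div_of_pos (by norm_num)]; simp, ← ENNReal.ofReal_mul (by positivity)]
        congr 1; ring
    _ ≤ _ := by gcongr

end Propagation

/-! ### The bounds from the computation times -/

section Sampling

variable {n d : ℕ} {env : Environment n} {Z : Type*} [MeasurableSpace Z]

theorem measure_sample_le {Ω : Type*} [MeasurableSpace Ω] (μ : Measure Ω) [IsProbabilityMeasure μ]
    {ι : Type*} (q : ι) {p : ℝ} (h0 : 0 ≤ p) (h1 : p ≤ 1) :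
    (μ.prod (Measure.infinitePi fun _ : ι => (volume : Measure unitInterval)))
      {ω | (ω.2 q : ℝ) ≤ p} = ENNReal.ofReal p := by
  have h2 := ((measurePreserving_eval_infinitePi
    (fun _ : ι => (volume : Measure unitInterval)) q).comp
      (measurePreserving_snd (μ := μ))).measure_preimage
        (measurableSet_unitInterval_le p).nullMeasurableSet
  rw [volume_unitInterval_le h0 h1] at h2
  exact h2

theorem half_le_prob_of_compl_le {Ω : Type*} [MeasurableSpace Ω] {μ : Measure Ω}
    [IsProbabilityMeasure μ] {G : Set Ω} (hG : MeasurableSet G) (h : μ Gᶜ ≤ 1 / 2) :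
    1 / 2 ≤ μ G := by
  have h1 := prob_add_prob_compl (μ := μ) hG
  by_contra! hcon
  have h2 : μ G + μ Gᶜ < 1 / 2 + 1 / 2 :=
    ENNReal.add_lt_add_of_lt_of_le (by finiteness) hcon h
  rw [h1, ENNReal.add_halves] at h2
  exact lt_irrefl _ h2

variable {T : ℕ} {e : ℕ → Fin d} {he : Set.InjOn e (Set.Iio T)} {a c σ2 : ℝ}
  {W : Fin n → ℕ → ℝ} {B p : Fin n → ℝ} {hW : ∀ i m, W i m ^ 2 ≤ B i} {hp0 : ∀ i, 0 < p i}
  {hp1 : ∀ i, p i ≤ 1} {hvar : ∀ i, (a * c) ^ 2 * B i * (1 / p i - 1) ≤ σ2}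

open Classical in
/-- The successful samples that the active workers complete by time `s`, among those that can be
completed by time `t`. -/
noncomputable def successes (env : Environment n) (S : Finset (Fin n)) (p : Fin n → ℝ) (t : ℝ≥0)
    (r : Trace n d) (ξ : Fin n × ℕ → unitInterval) (s : ℝ≥0) : Finset (Σ _ : Fin n, ℕ) :=
  (S.sigma fun i => Finset.range ⌊t / env.h i⌋₊).filter fun q =>
    r.start q.1 q.2 + env.h q.1 ≤ s ∧ (ξ (q.1, q.2) : ℝ) ≤ p q.1

theorem successes_mono {S : Finset (Fin n)} {t : ℝ≥0} {r : Trace n d}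
    {ξ : Fin n × ℕ → unitInterval} {s s' : ℝ≥0} (h : s ≤ s') :
    successes env S p t r ξ s ⊆ successes env S p t r ξ s' := by
  classical
  intro q hq
  simp only [successes, Finset.mem_filter] at hq ⊢
  exact ⟨hq.1, hq.2.1.trans (by exact_mod_cast h), hq.2.2⟩

/-- The progress along the chain is bounded by the number of successful samples. -/
theorem lt_card_successes {A : Algorithm env d Z} {ζ : Z} {ξ : Fin n × ℕ → unitInterval}
    {r : Trace n d}
    (hr : A.IsExecution ζ (chainProblem T e he a c σ2 W B p hW hp0 hp1 hvar).grad ξ r)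
    {S : Finset (Fin n)} (hS : ∀ i ∉ S, W i = 0) (t : ℝ≥0) (i : Fin n) {m : ℕ} (hm : m < T)
    (hν : e m ∈ (r.info (A.schedule ζ)
      (chainProblem T e he a c σ2 W B p hW hp0 hp1 hvar).grad ξ i t).support) :
    m < (successes env S p t r ξ t).card := by
  classical
  refine hr.known_induction
    (fun _ s ν => s ≤ t → ∀ m < T, e m = ν → m < (successes env S p t r ξ s).card)
    ?_ ?_ i t (e m) hν le_rfl m hm rfl
  · rintro i l s t' ν hs hst hx hg ht' k hk rfl
    have hss : s ≤ t' := le_self_add.trans hst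
    set N := (successes env S p t r ξ s).card with hN
    change ((a * c) • (chainGrad T e (W i) (c • r.point i l) +
      bernoulliNoise (p i) (ξ (i, l)) • freshPart T e (W i) (c • r.point i l))) (e k) ≠ 0 at hg
    have hg' := right_ne_zero_of_mul hg
    have h1 := noisyGrad_apply_ne_zero he hk (N := N) (fun j hj hne =>
      hx (e j) (right_ne_zero_of_mul hne) (hss.trans ht') j hj rfl) hg'
    have hmono := successes_mono (env := env) (S := S) (p := p) (t := t) (r := r) (ξ := ξ) hss
    rcases h1 with h1 | ⟨h1, h2⟩
    · exact h1.trans_le (Finset.card_le_card hmono)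
    -- The discovering sample is itself a success, and it is not among those counted at its starting
    -- time. Thus the count grows by at least one with each new coordinate.
    · refine h1.trans_lt (Finset.card_lt_card (Finset.ssubset_iff_subset_ne.2 ⟨hmono, fun heq => ?_⟩))
      have hiS : i ∈ S := by
        by_contra hcon
        refine hg' ?_
        rw [hS i hcon]
        simp [chainGrad, freshPart]
      have hpos := env.h_pos i
      have h3 : (⟨i, l⟩ : Σ _ : Fin n, ℕ) ∈ successes env S p t r ξ t' := by
        simp only [successes, Finset.mem_filter, Finset.mem_sigma, Finset.mem_range]
        refine ⟨⟨hiS, ?_⟩, ?_, bernoulliNoise_ne h2⟩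
        · have h4 := hr.mul_le_start i l
          rw [hs] at h4
          have h5 : (l : ℝ≥0) * env.h i ≤ s := by exact_mod_cast h4
          -- Sample `l` is the `(l + 1)`-st of its worker, so it completes no earlier than `(l + 1)
          -- * h i`.
          refine Nat.lt_of_succ_le (Nat.le_floor ?_)
          rw [le_div_iff₀ hpos, Nat.cast_succ, add_mul, one_mul]
          exact (add_le_add_left h5 _).trans (hst.trans ht')
        · rw [hs]; exact_mod_cast hst
      rw [← heq] at h3
      simp only [successes, Finset.mem_filter] at h3
      have h4 := h3.2.1
      rw [hs] at h4
      have h5 : s + env.h i ≤ s := by exact_mod_cast h4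
      exact absurd h5 (not_le.2 (lt_add_of_pos_right s hpos))
  · intro i k s t' j _ _ hst _ hK ht' m hm hmν
    exact (hK (hst.trans ht') m hm hmν).trans_le (Finset.card_le_card (successes_mono hst))

/-- The expected number of successes among all samples that could be complete by time `t` is at most
`T / 2`, so by Markov's inequality it stays below `T` with probability at least 1/2. Counting
potential samples makes the event depend on the noise alone; it is therefore measurable and
independent of the adaptive decisions. -/
theorem lt_expectedInf_of_sampling {ε : ℝ} (hε : 0 < ε) (hn : 0 < n)
    (hsum : ∀ m < T, ∑ i, W i m = n) (hT : 0 < T) (ha : 0 < a) (hc : 0 < c)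
    (hac : 4 * ε ≤ (a * c) ^ 2 / 16) (A : Algorithm env d Z) {S : Finset (Fin n)}
    (hS : ∀ i ∉ S, W i = 0) (t : ℝ≥0) (ht : (t : ℝ) * ∑ i ∈ S, p i / env.h i ≤ T / 2) :
    ENNReal.ofReal ε <
      A.expectedInf (chainProblem T e he a c σ2 W B p hW hp0 hp1 hvar) t := by
  classical
  set P := chainProblem T e he a c σ2 W B p hW hp0 hp1 hvar with hP
  let Q : Finset (Σ _ : Fin n, ℕ) := S.sigma fun i => Finset.range ⌊t / env.h i⌋₊
  let E : (Σ _ : Fin n, ℕ) → Set (Z × (Fin n × ℕ → unitInterval)) :=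
    fun q => {ω | (ω.2 (q.1, q.2) : ℝ) ≤ p q.1}
  have hE : ∀ q, MeasurableSet (E q) := fun q =>
    (measurableSet_unitInterval_le (p q.1)).preimage ((measurable_pi_apply _).comp measurable_snd)
  let cnt : Z × (Fin n × ℕ → unitInterval) → ℝ≥0∞ := fun ω => ∑ q ∈ Q, (E q).indicator 1 ω
  have hcnt : Measurable cnt :=
    Finset.measurable_sum _ fun q _ => measurable_one.indicator (hE q)
  let μ := A.seedLaw.prod (Measure.infinitePi fun _ : Fin n × ℕ => (volume : Measure unitInterval))
  have hint : ∫⁻ ω, cnt ω ∂μ ≤ ENNReal.ofReal (T / 2) := by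
    rw [lintegral_finsetSum _ fun q _ => measurable_one.indicator (hE q)]
    calc ∑ q ∈ Q, ∫⁻ ω, (E q).indicator 1 ω ∂μ
        = ∑ q ∈ Q, ENNReal.ofReal (p q.1) := Finset.sum_congr rfl fun q _ => by
          rw [lintegral_indicator_one (hE q)]
          exact measure_sample_le A.seedLaw (q.1, q.2) (hp0 q.1).le (hp1 q.1)
      _ = ENNReal.ofReal (∑ i ∈ S, ⌊t / env.h i⌋₊ * p i) := by
          rw [Finset.sum_sigma, ENNReal.ofReal_sum_of_nonneg fun i _ => by
            have := (hp0 i).le; positivity]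
          refine Finset.sum_congr rfl fun i _ => ?_
          dsimp only
          rw [Finset.sum_const, Finset.card_range, nsmul_eq_mul, ENNReal.ofReal_mul (by positivity),
            ENNReal.ofReal_natCast]
      _ ≤ ENNReal.ofReal (T / 2) := by
          refine ENNReal.ofReal_le_ofReal (le_trans ?_ ht)
          rw [Finset.mul_sum]
          refine Finset.sum_le_sum fun i _ => ?_
          have h1 : ((⌊t / env.h i⌋₊ : ℝ≥0) : ℝ) ≤ ((t / env.h i : ℝ≥0) : ℝ) :=
            NNReal.coe_le_coe.2 (Nat.floor_le zero_le)
          push_cast at h1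
          calc (⌊t / env.h i⌋₊ : ℝ) * p i ≤ t / env.h i * p i := by
                have := (hp0 i).le; gcongr
            _ = t * (p i / env.h i) := by ring
  let G : Set (Z × (Fin n × ℕ → unitInterval)) := {ω | cnt ω < T}
  have hG : MeasurableSet G := measurableSet_lt hcnt measurable_const
  have hhalf : 1 / 2 ≤ μ G := by
    refine half_le_prob_of_compl_le hG ?_
    have h1 := (mul_meas_ge_le_lintegral (μ := μ) hcnt (T : ℝ≥0∞)).trans hint
    have h2 : Gᶜ = {ω | (T : ℝ≥0∞) ≤ cnt ω} := by ext ω; simp [G]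
    rw [h2]
    have hT0 : (T : ℝ≥0∞) ≠ 0 := by exact_mod_cast hT.ne'
    have h3 : ENNReal.ofReal (T / 2) = T * (1 / 2) := by
      rw [ENNReal.ofReal_div_of_pos (by norm_num), ENNReal.ofReal_natCast]
      simp [div_eq_mul_inv]
    rw [h3] at h1
    exact (ENNReal.mul_le_mul_iff_right hT0 (by finiteness)).1 h1
  refine A.lt_expectedInf hε P t (e (T - 1)) (fun y hy => ?_) G hG hhalf ?_
  · exact hac.trans (le_norm_gradient_chainProblem hn hsum hT ha hc hy)
  · intro (ω : Z × (Fin n × ℕ → unitInterval)) hω i hν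
    have hω' : cnt ω < T := hω
    have h1 := lt_card_successes (A.isExecution_run ω.1 P.grad ω.2) hS t i (by omega) hν
    have h2 : ((successes env S p t (A.run ω.1 P.grad ω.2) ω.2 t).card : ℝ≥0∞) ≤ cnt ω := by
      have h3 : cnt ω = ((Q.filter fun q => ω ∈ E q).card : ℝ≥0∞) := by
        simp only [cnt, Set.indicator_apply, Pi.one_apply]
        rw [Finset.sum_boole]
      rw [h3]
      refine Nat.cast_le.2 (Finset.card_le_card fun q hq => ?_)
      simp only [successes, Finset.mem_filter] at hq ⊢
      exact ⟨hq.1, hq.2.2⟩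
    have h4 := h2.trans_lt hω'
    have h5 : (successes env S p t (A.run ω.1 P.grad ω.2) ω.2 t).card < T := by exact_mod_cast h4
    omega

end Sampling

/-! ### Transmissions across a cut -/

section Crossing

variable {n d : ℕ} {env : Environment n}

open Classical in
/-- The amount of data of one coordinate of a message that has crossed the cut, in either
direction. -/
noncomputable def Schedule.crossFlow (S : Schedule env d) (U : Set (Fin n)) (q : Fin n × ℕ × ℕ)
    (t : ℝ≥0) : ℝ≥0 :=
  ∑ u, ∑ v, if u ∈ U ↔ v ∈ U then 0 else S.flow q.1 q.2.1 q.2.2 u v t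

variable {S : Schedule env d} {U : Set (Fin n)}

theorem Schedule.crossFlow_mono (q : Fin n × ℕ × ℕ) : Monotone (S.crossFlow U q) := by
  intro s t h
  refine Finset.sum_le_sum fun u _ => Finset.sum_le_sum fun v _ => ?_
  split_ifs
  · exact le_rfl
  · exact S.flow_mono _ _ _ _ _ h

theorem Schedule.crossFlow_start {q : Fin n × ℕ × ℕ} {t : ℝ≥0}
    (h : (t : ℝ≥0∞) ≤ S.sendTime q.1 q.2.1) : S.crossFlow U q t = 0 := by
  simp [Schedule.crossFlow, S.flow_start _ _ _ _ _ t h]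

open Classical in
theorem Environment.sum_boundary_eq (env : Environment n) (U : Set (Fin n)) :
    ∑ u, ∑ v, (if u ∈ U ↔ v ∈ U then 0 else env.b u v) = 2 * env.cutValue U := by
  have h1 : ∀ u v, (if u ∈ U ↔ v ∈ U then 0 else env.b u v) =
      (if u ∈ U ∧ v ∉ U then env.b u v else 0) + if v ∈ U ∧ u ∉ U then env.b v u else 0 := by
    intro u v
    rw [env.b_symm v u]
    by_cases hu : u ∈ U <;> by_cases hv : v ∈ U <;> simp [hu, hv]
  simp only [h1, Finset.sum_add_distrib]
  rw [Finset.sum_comm (f := fun u v => if v ∈ U ∧ u ∉ U then env.b v u else 0), ← two_mul]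
  rfl

theorem Schedule.sum_crossFlow_le (Q : Finset (Fin n × ℕ × ℕ)) (t r : ℝ≥0) :
    ∑ q ∈ Q, S.crossFlow U q (t + r) ≤
      ∑ q ∈ Q, S.crossFlow U q t + 2 * env.cutValue U * r := by
  classical
  have h1 : ∀ t, ∑ q ∈ Q, S.crossFlow U q t = ∑ u, ∑ v, if u ∈ U ↔ v ∈ U then 0 else
      ∑ q ∈ Q, S.flow q.1 q.2.1 q.2.2 u v t := by
    intro t
    unfold Schedule.crossFlow
    rw [Finset.sum_comm]
    refine Finset.sum_congr rfl fun u _ => ?_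
    rw [Finset.sum_comm]
    refine Finset.sum_congr rfl fun v _ => ?_
    split_ifs <;> simp
  rw [h1, h1, ← env.sum_boundary_eq U, Finset.sum_mul, ← Finset.sum_add_distrib]
  refine Finset.sum_le_sum fun u _ => ?_
  rw [Finset.sum_mul, ← Finset.sum_add_distrib]
  refine Finset.sum_le_sum fun v _ => ?_
  split_ifs
  · simp
  · exact S.capacity u v t r Q

/-- Each crossing uses at least one unit of the capacity of the cut. The factor 2 accounts for the
two directions of every edge. -/
theorem Schedule.card_le_of_crossed (Q : Finset (Fin n × ℕ × ℕ)) (t : ℝ≥0)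
    (hQ : ∀ q ∈ Q, 1 ≤ S.crossFlow U q t) : (Q.card : ℝ≥0) ≤ 2 * env.cutValue U * t := by
  have h1 := S.sum_crossFlow_le (U := U) Q 0 t
  rw [zero_add, Finset.sum_eq_zero (f := fun q => S.crossFlow U q 0) fun q _ =>
    Schedule.crossFlow_start (by simp), zero_add] at h1
  refine le_trans ?_ h1
  have := Finset.card_nsmul_le_sum Q (fun q => S.crossFlow U q t) 1 hQ
  simpa using this

/-- The bandwidths make the crossed amount Lipschitz in time, so it cannot jump to 1. -/
theorem Schedule.exists_crossFlow_lt {q : Fin n × ℕ × ℕ} {t : ℝ≥0} (h : S.crossFlow U q t < 1) :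
    ∃ η : ℝ≥0, 0 < η ∧ S.crossFlow U q (t + η) < 1 := by
  set w := 2 * env.cutValue U with hw
  have hpos : 0 < 1 - S.crossFlow U q t := tsub_pos_of_lt h
  refine ⟨(1 - S.crossFlow U q t) / (w + 1), by positivity, ?_⟩
  have h1 := S.sum_crossFlow_le (U := U) {q} t ((1 - S.crossFlow U q t) / (w + 1))
  rw [Finset.sum_singleton, Finset.sum_singleton] at h1
  refine h1.trans_lt ?_
  have h2 : w * ((1 - S.crossFlow U q t) / (w + 1)) < 1 - S.crossFlow U q t := by
    rw [← mul_div_assoc, div_lt_iff₀ (by positivity), mul_comm]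
    exact mul_lt_mul_of_pos_left (lt_add_one w) hpos
  calc S.crossFlow U q t + w * ((1 - S.crossFlow U q t) / (w + 1))
      < S.crossFlow U q t + (1 - S.crossFlow U q t) := by gcongr
    _ = 1 := add_tsub_cancel_of_le h.le

/-- A coordinate that is delivered on the other side of the cut has crossed the cut. -/
theorem Schedule.Arrived.one_le_crossFlow {i : Fin n} {k j : ℕ} {t : ℝ≥0} (hA : S.Arrived i k t)
    (hj : j < S.size i k) (hside : ¬(i ∈ U ↔ S.dest i k ∈ U)) :
    1 ≤ S.crossFlow U (i, k, j) t := by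
  classical
  set F : Fin n → Fin n → ℝ≥0 := fun u v => S.flow i k j u v t with hF
  set D := S.dest i k with hD
  set C : Finset (Fin n) := Finset.univ.filter fun v => v ∈ U ↔ D ∈ U with hC
  have hDC : D ∈ C := by simp [hC]
  have hiC : i ∉ C := by simpa [hC] using hside
  -- Conservation is summed over the destination's side `C`, which does not contain the sender. The
  -- flow inside `C` occurs in both sums, so a full unit must enter from outside.
  have h1 : ∑ v ∈ C, ∑ u, F v u + 1 ≤ ∑ v ∈ C, ∑ u, F u v := by
    rw [← Finset.add_sum_erase C _ hDC, ← Finset.add_sum_erase C _ hDC]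
    have h2 : ∑ u, F D u = 0 := Finset.sum_eq_zero fun u _ => S.flow_dest i k j u t
    rw [h2, zero_add, add_comm]
    refine add_le_add (hA j hj) (Finset.sum_le_sum fun v hv => S.flow_conserve i k j v t ?_)
    rintro rfl
    exact hiC (Finset.mem_of_mem_erase hv)
  have h2 : ∑ v ∈ C, ∑ u, F u v = ∑ v ∈ C, ∑ u ∈ C, F u v + ∑ v ∈ C, ∑ u ∈ Cᶜ, F u v := by
    rw [← Finset.sum_add_distrib]
    exact Finset.sum_congr rfl fun v _ => (Finset.sum_add_sum_compl C _).symm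
  have h3 : ∑ v ∈ C, ∑ u ∈ C, F u v ≤ ∑ v ∈ C, ∑ u, F v u := by
    rw [Finset.sum_comm]
    exact Finset.sum_le_sum fun v _ => Finset.sum_le_sum_of_subset (Finset.subset_univ C)
  have h4 : 1 ≤ ∑ v ∈ C, ∑ u ∈ Cᶜ, F u v := by
    rw [h2] at h1
    exact (add_le_add_iff_left _).1 ((add_le_add_left h3 1).trans h1)
  refine h4.trans ?_
  unfold Schedule.crossFlow
  rw [Finset.sum_comm]
  refine (Finset.sum_le_sum fun u hu => ?_).trans
    (Finset.sum_le_sum_of_subset (Finset.subset_univ Cᶜ))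
  refine (Finset.sum_le_sum fun v hv => le_of_eq ?_).trans
    (Finset.sum_le_sum_of_subset (Finset.subset_univ C))
  have hv' : v ∈ U ↔ D ∈ U := by simpa [hC] using hv
  have hu' : ¬(u ∈ U ↔ D ∈ U) := by simpa [hC] using hu
  rw [if_neg]
  rwa [hv']

/-- The coordinates `e 0, …, e (m - 1)` have crossed the cut one after the other by time `t`. -/
def Schedule.Crossed (S : Schedule env d) (U : Set (Fin n)) (e : ℕ → Fin d) : ℕ → ℝ≥0 → Prop
  | 0, _ => True
  | m + 1, t => ∃ q : Fin n × ℕ × ℕ, ∃ r : ℚ≥0, (r : ℝ≥0) ≤ t ∧ S.Crossed U e m (r : ℝ≥0) ∧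
      S.idx q.1 q.2.1 q.2.2 = e m ∧ S.crossFlow U q (r : ℝ≥0) < 1 ∧ 1 ≤ S.crossFlow U q t

theorem Schedule.Crossed.mono {e : ℕ → Fin d} {m : ℕ} {s t : ℝ≥0} (h : S.Crossed U e m s)
    (hst : s ≤ t) : S.Crossed U e m t := by
  cases m with
  | zero => trivial
  | succ m =>
    obtain ⟨q, r, h1, h2, h3, h4, h5⟩ := h
    exact ⟨q, r, h1.trans hst, h2, h3, h4, h5.trans (Schedule.crossFlow_mono q hst)⟩

theorem exists_nnrat_btwn {s t : ℝ≥0} (h : s < t) : ∃ r : ℚ≥0, s < (r : ℝ≥0) ∧ (r : ℝ≥0) < t := by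
  obtain ⟨r, h1, h2⟩ := exists_rat_btwn (NNReal.coe_lt_coe.2 h)
  have h0 : (0 : ℚ) ≤ r := by
    have : (0 : ℝ) ≤ r := s.2.trans h1.le
    exact_mod_cast this
  refine ⟨⟨r, h0⟩, ?_, ?_⟩ <;> rw [← NNReal.coe_lt_coe] <;> simpa using ‹_›

/-- A worker that does not reveal the coordinate `e m` itself knows it only after all of
`e 0, …, e m` have crossed the cut. -/
theorem crossed_of_mem_support {Z : Type*} [MeasurableSpace Z] {A : Algorithm env d Z} {ζ : Z}
    {T : ℕ} {e : ℕ → Fin d} {he : Set.InjOn e (Set.Iio T)} {a c σ2 : ℝ}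
    {W : Fin n → ℕ → ℝ} {B : Fin n → ℝ} {hW : ∀ i m, W i m ^ 2 ≤ B i}
    {hp0 : ∀ _ : Fin n, (0 : ℝ) < 1} {hp1 : ∀ _ : Fin n, (1 : ℝ) ≤ 1}
    {hvar : ∀ i, (a * c) ^ 2 * B i * (1 / 1 - 1) ≤ σ2} {ξ : Fin n × ℕ → unitInterval} {r : Trace n d}
    (hr : A.IsExecution ζ (chainProblem T e he a c σ2 W B (fun _ => 1) hW hp0 hp1 hvar).grad ξ r)
    (hside : ∀ i m, W i m ≠ 0 → (i ∈ U ↔ Even m)) (t : ℝ≥0) (i : Fin n) {m : ℕ} (hm : m < T)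
    (hν : e m ∈ (r.info (A.schedule ζ)
      (chainProblem T e he a c σ2 W B (fun _ => 1) hW hp0 hp1 hvar).grad ξ i t).support) :
    (A.schedule ζ).Crossed U e m t := by
  -- Knowing `e m` on the side that holds link `m` requires `m` crossings. Knowing it on the other
  -- side requires that `e m` has crossed too.
  have key := hr.known_induction
    (fun i t ν => ∀ m < T, e m = ν → (A.schedule ζ).Crossed U e m t ∧
      (¬(i ∈ U ↔ Even m) → (A.schedule ζ).Crossed U e (m + 1) t)) ?_ ?_ i t (e m) hν m hm rfl
  · exact key.1
  · rintro i l s t ν hs hst hx hg k hk rfl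
    have hss : s ≤ t := le_self_add.trans hst
    change ((a * c) • (chainGrad T e (W i) (c • r.point i l) +
      bernoulliNoise 1 (ξ (i, l)) • freshPart T e (W i) (c • r.point i l))) (e k) ≠ 0 at hg
    rw [bernoulliNoise_one, zero_smul, add_zero] at hg
    rcases chainGrad_apply_ne_zero he hk (right_ne_zero_of_mul hg) with h1 | ⟨h1, h2⟩
    · have h3 := hx (e k) (right_ne_zero_of_mul h1) k hk rfl
      exact ⟨h3.1.mono hss, fun h => (h3.2 h).mono hss⟩
    · have h3 := hside i k h1
      refine ⟨?_, fun h => absurd h3 h⟩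
      -- Link `k + 1` is held on the side where `e k` is not revealed, so the second half of the
      -- invariant for `e k` supplies the crossing.
      cases k with
      | zero => trivial
      | succ k =>
        rw [chainVal_succ e _ (by omega)] at h2
        refine ((hx (e k) (right_ne_zero_of_mul h2) k (by omega) rfl).2 ?_).mono hss
        rw [h3, Nat.even_add_one]
        tauto
  · rintro i k s t j hs hA hst hj hK m hm hmν
    have h1 := hK m hm hmν
    refine ⟨h1.1.mono hst, fun hwrong => ?_⟩
    by_cases hi : i ∈ U ↔ Even m
    · have hcross : ¬(i ∈ U ↔ (A.schedule ζ).dest i k ∈ U) := by tauto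
      have h2 := hA.one_le_crossFlow hj hcross
      have h3 : (A.schedule ζ).crossFlow U (i, k, j) s = 0 :=
        Schedule.crossFlow_start (by simp [hs])
      obtain ⟨η, hη, h4⟩ := Schedule.exists_crossFlow_lt (h3 ▸ zero_lt_one)
      -- At the sending time nothing has crossed. A rational time shortly afterwards separates the
      -- earlier crossings from this one.
      obtain ⟨ρ, hρ1, hρ2⟩ := exists_nnrat_btwn (lt_add_of_pos_right s hη)
      have h5 := (Schedule.crossFlow_mono (i, k, j) hρ2.le).trans_lt h4
      refine ⟨(i, k, j), ρ, ?_, h1.1.mono hρ1.le, hmν.symm, h5, h2⟩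
      by_contra! hcon
      exact absurd (h2.trans (Schedule.crossFlow_mono _ hcon.le)) (not_le.2 h5)
    · exact (h1.2 hi).mono hst

/-- Messages and separating times range over countable sets, which is why `Crossed` uses rational
times. -/
theorem measurableSet_crossed {Z : Type*} [MeasurableSpace Z] (A : Algorithm env d Z)
    (U : Set (Fin n)) (e : ℕ → Fin d) (m : ℕ) (t : ℝ≥0) :
    MeasurableSet {ζ | (A.schedule ζ).Crossed U e m t} := by
  have hflow : ∀ q t, Measurable fun ζ => (A.schedule ζ).crossFlow U q t := by
    intro q t
    refine Finset.measurable_sum _ fun u _ => Finset.measurable_sum _ fun v _ => ?_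
    split_ifs
    · exact measurable_const
    · exact A.measurable_flow _ _ _ _ _ _
  rw [measurableSet_setOfPred]
  induction m generalizing t with
  | zero => exact measurable_const
  | succ m ih =>
    refine Measurable.exists fun q => Measurable.exists fun r => ?_
    refine measurable_const.and ((ih _).and (Measurable.and ?_ (Measurable.and ?_ ?_)))
    · exact measurableSet_setOfPred.1 (measurableSet_eq_fun (A.measurable_idx _ _ _) measurable_const)
    · exact measurableSet_setOfPred.1 (measurableSet_lt (hflow _ _) measurable_const)
    · exact measurableSet_setOfPred.1 (measurableSet_le measurable_const (hflow _ _))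

/-- The time at which a coordinate of a message has completely crossed the cut. -/
noncomputable def Schedule.crossTime (S : Schedule env d) (U : Set (Fin n)) (q : Fin n × ℕ × ℕ) :
    ℝ≥0 :=
  sInf {s | 1 ≤ S.crossFlow U q s}

theorem Schedule.crossTime_le {q : Fin n × ℕ × ℕ} {t : ℝ≥0} (h : 1 ≤ S.crossFlow U q t) :
    S.crossTime U q ≤ t := csInf_le (OrderBot.bddBelow _) h

theorem Schedule.lt_crossTime {q : Fin n × ℕ × ℕ} {s t : ℝ≥0} (h : S.crossFlow U q s < 1)
    (h' : 1 ≤ S.crossFlow U q t) : s < S.crossTime U q := by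
  obtain ⟨η, hη, h1⟩ := Schedule.exists_crossFlow_lt h
  refine (lt_add_of_pos_right s hη).trans_le (le_csInf ⟨t, h'⟩ fun r hr => ?_)
  by_contra! hcon
  exact absurd (hr.trans (Schedule.crossFlow_mono q hcon.le)) (not_le.2 h1)

/-- The separating times force the crossing times to increase strictly. This turns the recursive
definition into an ordered list of messages that can be counted. -/
theorem Schedule.Crossed.exists_sequence {e : ℕ → Fin d} {m : ℕ} {t : ℝ≥0}
    (h : S.Crossed U e m t) : ∃ f : Fin m → Fin n × ℕ × ℕ, (∀ k, 1 ≤ S.crossFlow U (f k) t) ∧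
      StrictMono (fun k => S.crossTime U (f k)) ∧
      ∀ k, S.idx (f k).1 (f k).2.1 (f k).2.2 = e k := by
  induction m generalizing t with
  | zero => exact ⟨Fin.elim0, fun k => k.elim0, fun k => k.elim0, fun k => k.elim0⟩
  | succ m ih =>
    obtain ⟨q, r, h1, h2, h3, h4, h5⟩ := h
    obtain ⟨f, hf1, hf2, hf3⟩ := ih h2
    refine ⟨Fin.snoc f q, fun k => ?_, fun k l hkl => ?_, fun k => ?_⟩
    · induction k using Fin.lastCases with
      | last => simpa using h5
      | cast k =>
        simpa using (hf1 k).trans (Schedule.crossFlow_mono (f k) h1)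
    · induction l using Fin.lastCases with
      | last =>
        obtain ⟨k, rfl⟩ : ∃ k', k = Fin.castSucc k' :=
          ⟨k.castPred (Fin.ne_of_lt hkl), by simp⟩
        simpa using (Schedule.crossTime_le (hf1 k)).trans_lt (Schedule.lt_crossTime h4 h5)
      | cast l =>
        obtain ⟨k, rfl⟩ : ∃ k', k = Fin.castSucc k' :=
          ⟨k.castPred (Fin.ne_of_lt (hkl.trans (Fin.castSucc_lt_last l))), by simp⟩
        simpa using hf2 (Fin.castSucc_lt_castSucc_iff.1 hkl)
    · induction k using Fin.lastCases with
      | last => simpa using h3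
      | cast k => simpa using hf3 k

end Crossing

/-! ### The bound from the communication: a random choice of the chain -/

/-- The set of messages used determines the order of the crossings, since two strictly increasing
enumerations with the same range agree. So this set determines the first `M` indices, and the last
index has at most `d` values. -/
theorem card_embeddings_le {d M : ℕ} {Q : Type*} (D : Finset Q) (τ : Q → ℝ≥0) (idx : Q → Fin d)
    (B : Finset (Fin (M + 1) ↪ Fin d))
    (h : ∀ π ∈ B, ∃ f : Fin M → Q, (∀ k, f k ∈ D) ∧ StrictMono (fun k => τ (f k)) ∧
      ∀ k, idx (f k) = π k.castSucc) : B.card ≤ D.card.choose M * d := by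
  classical
  have h' : ∀ π : B, ∃ f : Fin M → Q, (∀ k, f k ∈ D) ∧ StrictMono (fun k => τ (f k)) ∧
      ∀ k, idx (f k) = π.1 k.castSucc := fun π => h π.1 π.2
  choose f hf1 hf2 hf3 using h'
  have hinj : ∀ π, Function.Injective (f π) := fun π k l hkl =>
    (hf2 π).injective (congrArg τ hkl)
  let Φ : B → Finset Q × Fin d := fun π => (Finset.univ.image (f π), π.1 (Fin.last M))
  have hΦ : Function.Injective Φ := by
    intro π π' heq
    have h1 : Finset.univ.image (f π) = Finset.univ.image (f π') := congrArg Prod.fst heq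
    have h2 : π.1 (Fin.last M) = π'.1 (Fin.last M) := congrArg Prod.snd heq
    have hr : Set.range (f π) = Set.range (f π') := by
      have := congrArg (fun s : Finset Q => (s : Set Q)) h1
      simpa using this
    have h3 : (fun k => τ (f π k)) = fun k => τ (f π' k) := by
      refine ((hf2 π).range_inj (hf2 π')).1 ?_
      rw [← Function.comp_def, ← Function.comp_def, Set.range_comp, Set.range_comp, hr]
    have h4 : ∀ k, f π k = f π' k := by
      intro k
      obtain ⟨l, hl⟩ : f π k ∈ Set.range (f π') := hr ▸ ⟨k, rfl⟩
      have h5 : τ (f π' l) = τ (f π' k) := by rw [hl]; exact congrFun h3 k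
      rw [← hl, (hf2 π').injective h5]
    refine Subtype.ext (DFunLike.ext _ _ fun k => ?_)
    induction k using Fin.lastCases with
    | last => exact h2
    | cast k => rw [← hf3, ← hf3, h4]
  have hmem : ∀ π, Φ π ∈ D.powersetCard M ×ˢ (Finset.univ : Finset (Fin d)) := by
    intro π
    simp only [Φ, Finset.mem_product, Finset.mem_powersetCard, Finset.mem_univ, and_true]
    refine ⟨fun q hq => ?_, ?_⟩
    · obtain ⟨k, -, rfl⟩ := Finset.mem_image.1 hq
      exact hf1 π k
    · rw [Finset.card_image_of_injective _ (hinj π), Finset.card_univ, Fintype.card_fin]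
  calc B.card = (Finset.univ : Finset B).card := by simp
    _ ≤ (D.powersetCard M ×ˢ (Finset.univ : Finset (Fin d))).card :=
        Finset.card_le_card_of_injOn Φ (fun π _ => hmem π) hΦ.injOn
    _ = D.card.choose M * d := by simp

/-- From `N.choose M ≤ N ^ M / M!` and `M ^ M / M! ≤ exp M ≤ 3 ^ M` one gets `N.choose M ≤ (d / 8) ^
M ≤ (d / 2) ^ M / 4`. On the other side, each of the `M + 1` factors of the falling factorial is at
least `d / 2`. -/
theorem two_mul_choose_mul_le_descFactorial {d M N : ℕ} (hM : 1 ≤ M) (hd : 2 * (M + 1) ≤ d)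
    (hN : (N : ℝ) ≤ d * M / 24) : 2 * (N.choose M * d) ≤ d.descFactorial (M + 1) := by
  have h1 : (d / 2 : ℝ) ^ (M + 1) ≤ d.descFactorial (M + 1) := by
    have h2 : ((d + 1 - (M + 1) : ℕ) : ℝ) ^ (M + 1) ≤ d.descFactorial (M + 1) := by
      exact_mod_cast Nat.pow_sub_le_descFactorial d (M + 1)
    refine le_trans (pow_le_pow_left₀ (by positivity) ?_ _) h2
    rw [Nat.add_sub_add_right, Nat.cast_sub (by omega)]
    have : (2 * (M + 1) : ℝ) ≤ d := by exact_mod_cast hd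
    linarith
  have hd0 : (0 : ℝ) < d := by exact_mod_cast (by omega : 0 < d)
  have h3 : (N.choose M : ℝ) ≤ (d / 2 : ℝ) ^ M * (1 / 4) := by
    calc (N.choose M : ℝ) ≤ (N : ℝ) ^ M / M.factorial := Nat.choose_le_pow_div M N
      _ ≤ (d * M / 24 : ℝ) ^ M / M.factorial := by gcongr
      _ = (d / 2 : ℝ) ^ M * (1 / 12) ^ M * ((M : ℝ) ^ M / M.factorial) := by
          rw [show (d * M / 24 : ℝ) = d / 2 * (1 / 12) * M by ring, mul_pow, mul_pow]; ring
      _ ≤ (d / 2 : ℝ) ^ M * (1 / 12) ^ M * 3 ^ M := by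
          gcongr
          refine (Real.pow_div_factorial_le_exp M (by positivity) M).trans ?_
          rw [← Real.exp_one_pow]
          exact pow_le_pow_left₀ (Real.exp_pos _).le (by linarith [Real.exp_one_lt_d9]) _
      _ = (d / 2 : ℝ) ^ M * (1 / 4) ^ M := by rw [mul_assoc, ← mul_pow]; norm_num
      _ ≤ (d / 2 : ℝ) ^ M * (1 / 4) := by
          gcongr
          exact pow_le_of_le_one (by norm_num) (by norm_num) (by omega)
  have h4 : ((2 * (N.choose M * d) : ℕ) : ℝ) ≤ (d.descFactorial (M + 1) : ℝ) := by
    push_cast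
    calc 2 * ((N.choose M : ℝ) * d) ≤ 2 * ((d / 2 : ℝ) ^ M * (1 / 4) * d) := by gcongr
      _ = (d / 2 : ℝ) ^ (M + 1) := by ring
      _ ≤ _ := h1
  exact_mod_cast h4

/-- The chain of coordinates that belongs to an embedding. -/
def chainOf {d M : ℕ} (π : Fin (M + 1) ↪ Fin d) (m : ℕ) : Fin d :=
  -- The default is arbitrary; only the indices below `M + 1` belong to the chain.
  if h : m < M + 1 then π ⟨m, h⟩ else π 0

theorem chainOf_injOn {d M : ℕ} (π : Fin (M + 1) ↪ Fin d) :
    Set.InjOn (chainOf π) (Set.Iio (M + 1)) := by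
  intro k hk l hl h
  simp only [Set.mem_Iio] at hk hl
  simp only [chainOf, dif_pos hk, dif_pos hl] at h
  simpa using π.injective h

theorem chainOf_castSucc {d M : ℕ} (π : Fin (M + 1) ↪ Fin d) (k : Fin M) :
    chainOf π k = π k.castSucc := by
  simp only [chainOf, dif_pos (Nat.lt_succ_of_lt k.2)]
  rfl

section Communication

variable {n d : ℕ} {env : Environment n} {Z : Type*} [MeasurableSpace Z]

open Classical in
theorem card_crossed_embeddings_le {M : ℕ} (hM : 1 ≤ M) (hd : 2 * (M + 1) ≤ d)
    (S : Schedule env d) (U : Set (Fin n)) (t : ℝ≥0) (ht : (env.cutValue U * t : ℝ) ≤ d * M / 48) :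
    2 * (Finset.univ.filter fun π : Fin (M + 1) ↪ Fin d => S.Crossed U (chainOf π) M t).card ≤
      Fintype.card (Fin (M + 1) ↪ Fin d) := by
  set N := ⌊2 * env.cutValue U * t⌋₊ with hN
  have hbound : ∀ Q : Finset (Fin n × ℕ × ℕ), (∀ q ∈ Q, 1 ≤ S.crossFlow U q t) → Q.card ≤ N :=
    fun Q hQ => Nat.le_floor (Schedule.card_le_of_crossed Q t hQ)
  -- The capacity bound holds for every finite set of crossed coordinates with the same `N`,
  -- although infinitely many messages may be issued.
  have hfin : {q | 1 ≤ S.crossFlow U q t}.Finite := by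
    by_contra hinf
    obtain ⟨Q, hQ, hcard⟩ := Set.Infinite.exists_subset_card_eq hinf (N + 1)
    have := hbound Q fun q hq => hQ hq
    omega
  have h1 := card_embeddings_le hfin.toFinset (S.crossTime U) (fun q => S.idx q.1 q.2.1 q.2.2)
    (Finset.univ.filter fun π : Fin (M + 1) ↪ Fin d => S.Crossed U (chainOf π) M t) (by
      intro π hπ
      obtain ⟨f, hf1, hf2, hf3⟩ := (Finset.mem_filter.1 hπ).2.exists_sequence
      exact ⟨f, fun k => by simpa using hf1 k, hf2, fun k => by
        rw [hf3, chainOf_castSucc]⟩)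
  have h2 := hbound hfin.toFinset fun q hq => by simpa using hq
  have h3 : (N : ℝ) ≤ d * M / 24 := by
    have h4 : ((N : ℝ≥0) : ℝ) ≤ ((2 * env.cutValue U * t : ℝ≥0) : ℝ) :=
      NNReal.coe_le_coe.2 (Nat.floor_le zero_le)
    push_cast at h4
    linarith
  rw [Fintype.card_embedding_eq, Fintype.card_fin, Fintype.card_fin]
  refine le_trans ?_ (two_mul_choose_mul_le_descFactorial hM hd h3)
  gcongr
  exact h1.trans (Nat.mul_le_mul_right d (Nat.choose_le_choose M h2))

/-- Some chain is unlikely to cross the cut. -/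
theorem exists_chain_crossed_le_half {M : ℕ} (hM : 1 ≤ M) (hd : 2 * (M + 1) ≤ d)
    (A : Algorithm env d Z) (U : Set (Fin n)) (t : ℝ≥0)
    (ht : (env.cutValue U * t : ℝ) ≤ d * M / 48) :
    ∃ π : Fin (M + 1) ↪ Fin d,
      A.seedLaw {ζ | (A.schedule ζ).Crossed U (chainOf π) M t} ≤ 1 / 2 := by
  classical
  by_contra! hcon
  set E : (Fin (M + 1) ↪ Fin d) → Set Z := fun π =>
    {ζ | (A.schedule ζ).Crossed U (chainOf π) M t} with hE
  have hEm : ∀ π, MeasurableSet (E π) := fun π => measurableSet_crossed A U _ M t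
  have hne : (Finset.univ : Finset (Fin (M + 1) ↪ Fin d)).Nonempty :=
    ⟨Fin.castLEEmb (by omega), Finset.mem_univ _⟩
  set K := Fintype.card (Fin (M + 1) ↪ Fin d) with hK
  -- Double counting: for every seed at most half of the embeddings have crossed. Hence the
  -- probabilities average to at most 1/2 and cannot all exceed it.
  have h1 : ∑ π, A.seedLaw (E π) ≤ K / 2 := by
    calc ∑ π, A.seedLaw (E π) = ∫⁻ ζ, ∑ π, (E π).indicator 1 ζ ∂A.seedLaw := by
          rw [lintegral_finsetSum _ fun π _ => measurable_one.indicator (hEm π)]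
          exact Finset.sum_congr rfl fun π _ => (lintegral_indicator_one (hEm π)).symm
      _ ≤ ∫⁻ _, (K / 2 : ℝ≥0∞) ∂A.seedLaw := by
          refine lintegral_mono fun ζ => ?_
          simp only [Set.indicator_apply, Pi.one_apply]
          rw [Finset.sum_boole, ENNReal.le_div_iff_mul_le (by simp) (by simp), mul_comm]
          exact_mod_cast card_crossed_embeddings_le hM hd (A.schedule ζ) U t ht
      _ = K / 2 := by simp
  have h2 : ∑ _π : Fin (M + 1) ↪ Fin d, (1 / 2 : ℝ≥0∞) < ∑ π, A.seedLaw (E π) :=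
    ENNReal.sum_lt_sum_of_nonempty hne fun π _ => hcon π
  rw [Finset.sum_const, Finset.card_univ, nsmul_eq_mul, mul_one_div] at h2
  exact absurd (h2.trans_le h1) (lt_irrefl _)

/-- With success probabilities 1 the oracle is exact, so the good event concerns the seed only. The
last coordinate `e M` is known only after the `M` preceding ones have crossed. -/
theorem lt_expectedInf_of_cut {M : ℕ} {a c σ2 ε : ℝ} {W : Fin n → ℕ → ℝ} {B : Fin n → ℝ}
    {hW : ∀ i m, W i m ^ 2 ≤ B i}
    {hp0 : ∀ _ : Fin n, (0 : ℝ) < 1} {hp1 : ∀ _ : Fin n, (1 : ℝ) ≤ 1}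
    {hvar : ∀ i, (a * c) ^ 2 * B i * (1 / 1 - 1) ≤ σ2}
    (hε : 0 < ε) (hn : 0 < n) (hsum : ∀ m < M + 1, ∑ i, W i m = n) (ha : 0 < a) (hc : 0 < c)
    (hac : 4 * ε ≤ (a * c) ^ 2 / 16) (A : Algorithm env d Z) {U : Set (Fin n)}
    (hside : ∀ i m, W i m ≠ 0 → (i ∈ U ↔ Even m)) (t : ℝ≥0) (π : Fin (M + 1) ↪ Fin d)
    (hπ : A.seedLaw {ζ | (A.schedule ζ).Crossed U (chainOf π) M t} ≤ 1 / 2) :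
    ENNReal.ofReal ε < A.expectedInf
      (chainProblem (M + 1) (chainOf π) (chainOf_injOn π) a c σ2 W B (fun _ => 1) hW hp0 hp1
        hvar) t := by
  set P := chainProblem (M + 1) (chainOf π) (chainOf_injOn π) a c σ2 W B (fun _ => 1) hW hp0 hp1
    hvar with hP
  set E : Set Z := {ζ | (A.schedule ζ).Crossed U (chainOf π) M t} with hE
  have hEm : MeasurableSet E := measurableSet_crossed A U _ M t
  let G : Set (Z × (Fin n × ℕ → P.Ξ)) := Eᶜ ×ˢ Set.univ
  refine A.lt_expectedInf hε P t (chainOf π M) (fun y hy => ?_) G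
    (hEm.compl.prod MeasurableSet.univ) ?_ ?_
  · exact hac.trans (le_norm_gradient_chainProblem hn hsum M.succ_pos ha hc hy)
  · rw [Measure.prod_prod, measure_univ, mul_one]
    exact half_le_prob_of_compl_le hEm.compl (by rwa [compl_compl])
  · intro ω hω i hν
    exact hω.1 (crossed_of_mem_support (A.isExecution_run ω.1 P.grad ω.2) hside t i
      (Nat.lt_succ_self M) hν)

end Communication

/-! ### The three lower bounds -/

section Bounds

/-- The product `a * c = 8 * √ε` makes the gradient bound `(a * c) ^ 2 / 16` equal to `4 * ε`. The
smoothness constraint is then met with equality, and the gap constraint becomes the stated bound on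
`T`. -/
theorem exists_scaling {L Δ ε : ℝ} (hL : 0 < L) (hε : 0 < ε) {T : ℕ}
    (hT : T ≤ L * Δ / ε / 15360) : ∃ a c : ℝ, 0 < a ∧ 0 < c ∧ (a * c) ^ 2 = 64 * ε ∧
      60 * (a * c ^ 2) ≤ L ∧ 4 * a * T ≤ Δ := by
  have hs : 0 < √ε := Real.sqrt_pos.2 hε
  have hsq : √ε ^ 2 = ε := Real.sq_sqrt hε.le
  have hac : 3840 * ε / L * (L / (480 * √ε)) = 8 * √ε := by
    field_simp
    linarith
  refine ⟨3840 * ε / L, L / (480 * √ε), by positivity, by positivity, ?_, le_of_eq ?_, ?_⟩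
  · rw [hac, mul_pow, hsq]; norm_num
  · rw [sq, ← mul_assoc (3840 * ε / L), hac]
    field_simp
    norm_num
  · rw [div_div, le_div_iff₀ (by positivity)] at hT
    have : 4 * (3840 * ε / L) * T = T * (ε * 15360) / L := by ring
    rw [this, div_le_iff₀ hL]
    linarith

variable {n d : ℕ} {env : Environment n} {Z : Type*} [MeasurableSpace Z] {L Δ ε σ2 : ℝ} {T : ℕ}

/-- A chain on the first coordinates. -/
def initialChain (d : ℕ) (hd : 0 < d) (m : ℕ) : Fin d := if h : m < d then ⟨m, h⟩ else ⟨0, hd⟩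

theorem initialChain_injOn {hd : 0 < d} (hT : T ≤ d) :
    Set.InjOn (initialChain d hd) (Set.Iio T) := by
  intro k hk l hl h
  simp only [Set.mem_Iio] at hk hl
  simp only [initialChain, dif_pos (hk.trans_le hT), dif_pos (hl.trans_le hT)] at h
  simpa using h

/-- Common core of the two computation bounds, with weights that are constant along the chain. One
problem serves all times up to `b`. -/
theorem exists_hard_of_sampling (hL : 0 < L) (hε : 0 < ε) (hn : 0 < n)
    (hT0 : 0 < T) (hTd : T ≤ d) (hT : T ≤ L * Δ / ε / 15360) (A : Algorithm env d Z)
    (ω p : Fin n → ℝ) (hω : ∑ i, ω i = n) (hp0 : ∀ i, 0 < p i) (hp1 : ∀ i, p i ≤ 1)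
    (hvar : ∀ i, 64 * ε * ω i ^ 2 * (1 / p i - 1) ≤ σ2) (S : Finset (Fin n))
    (hS : ∀ i ∉ S, ω i = 0) (b : ℝ) (hb : b * ∑ i ∈ S, p i / env.h i ≤ T / 2) :
    ∃ P : HeterogeneousProblem n d σ2, InClass Δ L P.objective ∧
      ∀ t : ℝ≥0, (t : ℝ) ≤ b → ENNReal.ofReal ε < A.expectedInf P t := by
  obtain ⟨a, c, ha, hc, hac, hac2, haT⟩ := exists_scaling hL hε hT
  have hd : 0 < d := hT0.trans_le hTd
  refine ⟨chainProblem T (initialChain d hd) (initialChain_injOn hTd) a c σ2 (fun i _ => ω i)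
    (fun i => ω i ^ 2) p (fun _ _ => le_rfl) hp0 hp1 (fun i => by rw [hac]; exact hvar i),
    inClass_chainProblem hn (fun _ _ => hω) ha hc hac2 haT, fun t ht => ?_⟩
  refine lt_expectedInf_of_sampling hε hn (fun _ _ => hω) hT0 ha hc (by rw [hac]; linarith) A
    (S := S) (fun i hi => by funext m; exact hS i hi) t (le_trans ?_ hb)
  refine mul_le_mul_of_nonneg_right ht (Finset.sum_nonneg fun i _ => ?_)
  exact div_nonneg (hp0 i).le (NNReal.coe_nonneg _)

/-- One worker holds the whole objective. -/
theorem exists_hard_of_worker (hL : 0 < L) (hε : 0 < ε) (hσ : 0 ≤ σ2) (hn : 0 < n)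
    (hT0 : 0 < T) (hTd : T ≤ d) (hT : T ≤ L * Δ / ε / 15360) (A : Algorithm env d Z)
    (i₀ : Fin n) (b : ℝ) (hb : b ≤ env.h i₀ * (T / 2)) :
    ∃ P : HeterogeneousProblem n d σ2, InClass Δ L P.objective ∧
      ∀ t : ℝ≥0, (t : ℝ) ≤ b → ENNReal.ofReal ε < A.expectedInf P t := by
  have h0 : (0 : ℝ) < env.h i₀ := env.h_pos i₀
  -- Exact oracle and a single active worker; the weight `n` compensates the factor `1 / n` of the
  -- average.
  refine exists_hard_of_sampling hL hε hn hT0 hTd hT A (fun i => if i = i₀ then n else 0)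
    (fun _ => 1) (by simp) (fun _ => one_pos) (fun _ => le_rfl) (fun i => by simpa using hσ) {i₀}
    (fun i hi => if_neg (by simpa using hi)) b ?_
  rw [Finset.sum_singleton, mul_one_div, div_le_iff₀ h0]
  linarith

/-- The workers hold parts of the objective in proportion to their computation times. -/
theorem exists_hard_of_variance (hL : 0 < L) (hε : 0 < ε) (hσ : 0 < σ2) (hn : 0 < n)
    (hT0 : 0 < T) (hTd : T ≤ d) (hT : T ≤ L * Δ / ε / 15360) (A : Algorithm env d Z)
    (b : ℝ) (hb0 : 0 ≤ b)
    (hb : b ≤ σ2 / (n * ε) * ((∑ i, (env.h i : ℝ)) / n) * (T / 128)) :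
    ∃ P : HeterogeneousProblem n d σ2, InClass Δ L P.objective ∧
      ∀ t : ℝ≥0, (t : ℝ) ≤ b → ENNReal.ofReal ε < A.expectedInf P t := by
  set H : ℝ := ∑ i, (env.h i : ℝ) with hH
  have hh : ∀ i, (0 : ℝ) < env.h i := fun i => env.h_pos i
  have hHpos : 0 < H := Finset.sum_pos (fun i _ => hh i) ⟨⟨0, hn⟩, Finset.mem_univ _⟩
  have hn' : (0 : ℝ) < n := by exact_mod_cast hn
  -- The rate of successes is governed by `∑ ω i ^ 2 / h i`. Under `∑ ω i = n` it is smallest, by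
  -- Cauchy–Schwarz, for weights proportional to `h i`.
  set ω : Fin n → ℝ := fun i => n * env.h i / H with hω
  -- At this probability the second moment `64 * ε * ω i ^ 2 / ρ i` equals `σ2`. If it exceeds 1 it
  -- is capped, and the oracle is exact.
  set ρ : Fin n → ℝ := fun i => 64 * ε * ω i ^ 2 / σ2 with hρ
  have hωpos : ∀ i, 0 < ω i := fun i => by have := hh i; positivity
  have hρpos : ∀ i, 0 < ρ i := fun i => by have := hωpos i; positivity
  refine exists_hard_of_sampling hL hε hn hT0 hTd hT A ω (fun i => min 1 (ρ i))
    ?_ (fun i => lt_min one_pos (hρpos i)) (fun i => min_le_left _ _) (fun i => ?_) Finset.univ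
    (fun i hi => absurd (Finset.mem_univ i) hi) b ?_
  · simp only [hω]
    rw [← Finset.sum_div, ← Finset.mul_sum, ← hH]
    field_simp
  · rcases le_total 1 (ρ i) with h | h
    · rw [min_eq_left h]; simpa using hσ.le
    · rw [min_eq_right h]
      have h1 : 64 * ε * ω i ^ 2 * (1 / ρ i) = σ2 := by
        have := hωpos i
        simp only [hρ]
        field_simp
      have h2 : 0 ≤ 64 * ε * ω i ^ 2 := by positivity
      rw [mul_sub, h1]
      linarith
  · have h1 : ∑ i, min 1 (ρ i) / env.h i ≤ 64 * ε * n ^ 2 / (H * σ2) := by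
      calc ∑ i, min 1 (ρ i) / (env.h i : ℝ) ≤ ∑ i, 64 * ε * n ^ 2 / (H ^ 2 * σ2) * env.h i := by
            refine Finset.sum_le_sum fun i _ => ?_
            have h2 := hh i
            calc min 1 (ρ i) / (env.h i : ℝ) ≤ ρ i / env.h i := by gcongr; exact min_le_right _ _
              _ = _ := by simp only [hρ, hω]; field_simp
        _ = 64 * ε * n ^ 2 / (H * σ2) := by
            rw [← Finset.mul_sum, ← hH]; field_simp
    calc b * ∑ i, min 1 (ρ i) / (env.h i : ℝ)
        ≤ (σ2 / (n * ε) * (H / n) * (T / 128)) * (64 * ε * n ^ 2 / (H * σ2)) :=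
          mul_le_mul hb h1 (Finset.sum_nonneg fun i _ =>
            div_nonneg (lt_min one_pos (hρpos i)).le (hh i).le) (hb0.trans hb)
      _ = T / 2 := by field_simp; norm_num

/-- A path from `i` to `j` in the connected graph contains an edge that leaves `U`. -/
theorem Environment.cutValue_pos (env : Environment n) {U : Set (Fin n)} {i j : Fin n}
    (hi : i ∈ U) (hj : j ∉ U) : 0 < env.cutValue U := by
  classical
  obtain ⟨p⟩ := env.connected.preconnected i j
  obtain ⟨e, -, h1, h2⟩ := p.exists_boundary_dart U hi hj
  have h3 : 0 < env.b e.fst e.snd := (env.b_pos_iff _ _).2 e.adj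
  refine h3.trans_le ?_
  unfold Environment.cutValue
  refine le_trans ?_ (Finset.single_le_sum (f := fun u => ∑ v, if u ∈ U ∧ v ∉ U then env.b u v
    else 0) (fun _ _ => zero_le) (Finset.mem_univ e.fst))
  refine le_trans ?_ (Finset.single_le_sum (f := fun v => if e.fst ∈ U ∧ v ∉ U then env.b e.fst v
    else 0) (fun _ _ => zero_le) (Finset.mem_univ e.snd))
  simp [h1, h2]

/-- The links of the chain alternate between two workers on different sides of a cut. -/
theorem exists_hard_of_cut {M : ℕ} (hL : 0 < L) (hε : 0 < ε) (hσ : 0 ≤ σ2) (hM : 1 ≤ M)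
    (hd : 2 * (M + 1) ≤ d) (hT : ((M + 1 : ℕ) : ℝ) ≤ L * Δ / ε / 15360) (A : Algorithm env d Z)
    {U : Set (Fin n)} {i j : Fin n} (hi : i ∈ U) (hj : j ∉ U) :
    ∃ P : HeterogeneousProblem n d σ2, InClass Δ L P.objective ∧
      ∀ t : ℝ≥0, (t : ℝ) ≤ d / env.cutValue U * (M / 48) →
        ENNReal.ofReal ε < A.expectedInf P t := by
  obtain ⟨a, c, ha, hc, hac, hac2, haT⟩ := exists_scaling hL hε hT
  have hn : 0 < n := i.pos
  have hw : (0 : ℝ) < env.cutValue U := env.cutValue_pos hi hj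
  -- The chain is chosen for the latest time allowed; it serves all earlier times because `Crossed`
  -- is monotone in time.
  set t₀ : ℝ≥0 := d / env.cutValue U * (M / 48) with ht₀
  have ht₀' : (t₀ : ℝ) = d / env.cutValue U * (M / 48) := by simp [ht₀]
  obtain ⟨π, hπ⟩ := exists_chain_crossed_le_half hM hd A U t₀ (by
    rw [ht₀']; field_simp; exact le_rfl)
  -- Even links at `i`, odd links at `j`: consecutive coordinates are revealed on opposite sides of
  -- the cut.
  set W : Fin n → ℕ → ℝ := fun u m =>
    if u = (if Even m then i else j) then (n : ℝ) else 0 with hW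
  have hsum : ∀ m < M + 1, ∑ u, W u m = n := fun m _ => by simp [hW]
  have hside : ∀ u m, W u m ≠ 0 → (u ∈ U ↔ Even m) := by
    intro u m h
    have hu : u = if Even m then i else j := by
      by_contra hne; exact h (if_neg hne)
    by_cases hm : Even m
    · rw [if_pos hm] at hu; subst hu; simp [hm, hi]
    · rw [if_neg hm] at hu; subst hu; simp [hm, hj]
  have hWle : ∀ u m, W u m ^ 2 ≤ (fun _ => (n : ℝ) ^ 2) u := by
    intro u m
    rcases ite_eq_or_eq (u = if Even m then i else j) (n : ℝ) 0 with h | h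
    · exact (congrArg (· ^ 2) h).le
    · exact (congrArg (· ^ 2) h).le.trans (show (0 : ℝ) ^ 2 ≤ (n : ℝ) ^ 2 by
        rw [zero_pow two_ne_zero]; positivity)
  refine ⟨chainProblem (M + 1) (chainOf π) (chainOf_injOn π) a c σ2 W _ (fun _ => 1) hWle
    (fun _ => one_pos) (fun _ => le_rfl) (fun _ => by simpa using hσ),
    inClass_chainProblem hn hsum ha hc hac2 haT, fun t ht => ?_⟩
  refine lt_expectedInf_of_cut hε hn hsum ha hc (by rw [hac]; linarith) A hside t π
    (le_trans (measure_mono fun ζ hζ => ?_) hπ)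
  exact Schedule.Crossed.mono hζ (NNReal.coe_le_coe.1 (ht.trans_eq ht₀'.symm))

theorem exists_adj_eq_minWeight {G : SimpleGraph (Fin n)} {w : Fin n → Fin n → ℝ≥0}
    (h : minWeight G w ≠ ∞) : ∃ i j, G.Adj i j ∧ minWeight G w = w i j := by
  have : Nonempty (Fin n) := by
    by_contra hne
    rw [not_nonempty_iff] at hne
    exact h (by simp [minWeight])
  obtain ⟨i, hi⟩ := exists_eq_ciInf_of_finite
    (f := fun i : Fin n => ⨅ (j : Fin n) (_ : G.Adj i j), (w i j : ℝ≥0∞))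
  obtain ⟨j, hj⟩ := exists_eq_ciInf_of_finite
    (f := fun j : Fin n => ⨅ (_ : G.Adj i j), (w i j : ℝ≥0∞))
  have h1 : minWeight G w = ⨅ (_ : G.Adj i j), (w i j : ℝ≥0∞) := hi.symm.trans hj.symm
  by_cases hadj : G.Adj i j
  · exact ⟨i, j, hadj, by simpa [hadj] using h1⟩
  · exact absurd (by simpa [hadj] using h1) h

theorem coe_le_of_le_ofReal {t : ℝ≥0} {α X κ : ℝ} (hα : 0 ≤ α) (hX : 0 ≤ X) (hκ : 0 ≤ κ)
    (h : (t : ℝ≥0∞) ≤ ENNReal.ofReal α * ENNReal.ofReal X * ENNReal.ofReal κ) :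
    (t : ℝ) ≤ α * X * κ := by
  rw [← ENNReal.ofReal_mul hα, ← ENNReal.ofReal_mul (by positivity), ← ENNReal.ofReal_coe_nnreal,
    ENNReal.ofReal_le_ofReal_iff (by positivity)] at h
  exact h

end Bounds

end Decentralized

/-! ### Choice of the constants and of the dominating term. -/

open Decentralized
open scoped NNReal ENNReal
theorem theorem4 :
    ∃ c₁ c₂ c₃ : ℝ, 0 < c₁ ∧ 0 < c₂ ∧ 0 < c₃ ∧
      ∀ (n d : ℕ) (env : Environment n) (T : SimpleGraph (Fin n)) (w : Fin n → Fin n → ℝ≥0),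
        env.IsGomoryHuTree T w →
      ∀ L Δ ε σ2 : ℝ, 0 < L → 0 < Δ → 0 < ε → 0 < σ2 →
        c₁ ≤ L * Δ / ε → c₃ * (L * Δ / ε) ≤ d →
      ∀ (Z : Type*) [MeasurableSpace Z] (A : Algorithm env d Z),
        ∃ P : HeterogeneousProblem n d σ2, InClass Δ L P.objective ∧
          ∀ t : ℝ≥0,
            (t : ℝ≥0∞) ≤ ENNReal.ofReal c₂ *
                max ((d : ℝ≥0∞) / minWeight T w)
                  (max (⨆ i, (env.h i : ℝ≥0∞))
                    (ENNReal.ofReal (σ2 / (n * ε)) * ((∑ i, (env.h i : ℝ≥0∞)) / n))) *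
                ENNReal.ofReal (L * Δ / ε) →
            ENNReal.ofReal ε < A.expectedInf P t := by
  -- The chain has length `N = ⌊κ / 15360⌋`, as `exists_scaling` permits, and `κ ≥ 30720` gives `N ≥
  -- 2`. Then `κ < 15360 * (N + 1)` is at most `23040 * N` and at most `46080 * (N - 1)`, so the
  -- second constant puts `κ` below `N / 128` and `(N - 1) / 48`. From `d ≥ κ` it follows that `d ≥
  -- 2 * N`.
  refine ⟨30720, 1 / 4000000, 1, by norm_num, by norm_num, by norm_num, ?_⟩
  intro n d env T w hT L Δ ε σ2 hL hΔ hε hσ hκ1 hκd Z _ A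
  set κ := L * Δ / ε with hκ
  have hκ0 : 0 < κ := by linarith
  have hne : Nonempty (Fin n) := env.connected.nonempty
  have hn : 0 < n := Fin.pos_iff_nonempty.2 hne
  have hn' : (0 : ℝ) < n := by exact_mod_cast hn
  set N := ⌊κ / 15360⌋₊ with hN
  have hN1 : (N : ℝ) ≤ κ / 15360 := Nat.floor_le (by positivity)
  have hN2 : κ / 15360 < N + 1 := Nat.lt_floor_add_one _
  have hN3 : 2 ≤ N := Nat.le_floor (by push_cast; linarith)
  have hN3' : (2 : ℝ) ≤ N := by exact_mod_cast hN3
  have hd2 : (2 * N : ℝ) ≤ d := by linarith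
  have hd2' : 2 * N ≤ d := by exact_mod_cast hd2
  have hd0 : (0 : ℝ) < d := by linarith
  by_cases hcut : (d : ℝ≥0∞) / minWeight T w ≤ max (⨆ i, (env.h i : ℝ≥0∞))
      (ENNReal.ofReal (σ2 / (n * ε)) * ((∑ i, (env.h i : ℝ≥0∞)) / n))
  · rw [max_eq_right hcut]
    rcases le_total (ENNReal.ofReal (σ2 / (n * ε)) * ((∑ i, (env.h i : ℝ≥0∞)) / n))
      (⨆ i, (env.h i : ℝ≥0∞)) with hcase | hcase
    · rw [max_eq_left hcase]
      obtain ⟨i₀, hi₀⟩ := exists_eq_ciSup_of_finite (f := fun i => (env.h i : ℝ≥0∞))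
      rw [← hi₀]
      have hh : (0 : ℝ) ≤ env.h i₀ := NNReal.coe_nonneg _
      obtain ⟨P, hP, hP'⟩ := exists_hard_of_worker hL hε hσ.le hn (by omega) (by omega) hN1 A i₀
        (1 / 4000000 * env.h i₀ * κ) (by nlinarith)
      refine ⟨P, hP, fun t ht => hP' t (coe_le_of_le_ofReal (by norm_num) hh hκ0.le ?_)⟩
      rwa [ENNReal.ofReal_coe_nnreal]
    · rw [max_eq_right hcase]
      set X : ℝ := σ2 / (n * ε) * ((∑ i, (env.h i : ℝ)) / n) with hX
      have hX0 : 0 ≤ X := by positivity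
      have hXeq : ENNReal.ofReal (σ2 / (n * ε)) * ((∑ i, (env.h i : ℝ≥0∞)) / n) =
          ENNReal.ofReal X := by
        rw [hX, ENNReal.ofReal_mul (by positivity), ENNReal.ofReal_div_of_pos hn',
          ENNReal.ofReal_natCast, ENNReal.ofReal_sum_of_nonneg fun i _ => NNReal.coe_nonneg _]
        simp only [ENNReal.ofReal_coe_nnreal]
      rw [hXeq]
      obtain ⟨P, hP, hP'⟩ := exists_hard_of_variance hL hε hσ hn (by omega) (by omega) hN1 A
        (1 / 4000000 * X * κ) (by positivity) (by rw [← hX]; nlinarith)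
      exact ⟨P, hP, fun t ht => hP' t (coe_le_of_le_ofReal (by norm_num) hX0 hκ0.le ht)⟩
  · rw [max_eq_left (not_le.1 hcut).le]
    -- The quotient exceeds another quantity, so it is not 0. Hence the tree has an edge.
    have hfin : minWeight T w ≠ ∞ := by
      intro h
      rw [h, ENNReal.div_top] at hcut
      exact hcut zero_le
    obtain ⟨i, j, hadj, hmin⟩ := exists_adj_eq_minWeight hfin
    obtain ⟨hi, hj, -⟩ := hT.isMinCut i j hadj
    have hw : w i j = env.cutValue (sideOf T i j) := hT.weight_eq i j hadj
    have hw0 : (0 : ℝ) < env.cutValue (sideOf T i j) := env.cutValue_pos hi hj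
    -- The chain has `M + 1` coordinates, of which all but the last must cross the cut.
    obtain ⟨M, hM⟩ : ∃ M, N = M + 1 := ⟨N - 1, by omega⟩
    obtain ⟨P, hP, hP'⟩ := exists_hard_of_cut hL hε hσ.le (M := M) (by omega) (by omega)
      (by rw [← hM]; exact hN1) A hi hj
    refine ⟨P, hP, fun t ht => hP' t ?_⟩
    have hM' : (N : ℝ) = M + 1 := by exact_mod_cast hM
    have hX0 : (0 : ℝ) ≤ d / env.cutValue (sideOf T i j) := by positivity
    have hXeq : (d : ℝ≥0∞) / minWeight T w =
        ENNReal.ofReal (d / env.cutValue (sideOf T i j)) := by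
      rw [hmin, hw, ENNReal.ofReal_div_of_pos hw0, ENNReal.ofReal_natCast,
        ENNReal.ofReal_coe_nnreal]
    rw [hXeq] at ht
    refine (coe_le_of_le_ofReal (by norm_num) hX0 hκ0.le ht).trans ?_
    rw [mul_comm (1 / 4000000 : ℝ), mul_assoc]
    refine mul_le_mul_of_nonneg_left ?_ hX0
    linarith
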